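/- Let $\mathfrak A$ be a countably infinite alphabet and, for an integer $m\ge 0$, let $J_m$ be the set of all identities $\mathbf u\approx\mathbf v$ between words $\mathbf u,\mathbf v\in\mathfrak A^+$ such that $\mathbf u$ and $\mathbf v$ have the same set of scattered subwords (subsequences) of length at most $m$. A set of identities $\Sigma$ is called finitely based if all identities in $\Sigma$ can be derived (by the rules of equational logic for semigroups) from a finite subset of $\Sigma$. Then for every integer $m\ge 0$: (1) $J_m$ is finitely based if and only if $m\le 3$. (2) $J_m$ is the equational theory of the piecewise $m$-testable languages, i.e. the set of all identities that hold in the syntactic monoid of every piecewise $m$-testable language over a finite alphabet $B$. (A language over $B$ is piecewise $m$-testable if it is a Boolean combination of languages $B^*b_1B^*b_2\cdots B^*b_kB^*$ with $0\le k\le m$ and $b_1,\dots,b_k\in B$.) (3) $J_m$ is the equational theory of the monoid $S_{m+1}$ of all reflexive binary relations on a set with $m+1$ elements, under composition. Consequently, the equational theory of the piecewise $m$-testable languages, and that of $S_{m+1}$, is finitely based if and only if $m\le 3$. -/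

import Mathlib

namespace PiecewiseTestable

/-- A semigroup identity `u ≈ v` over the alphabet `α` of variables:
a pair of words of the free semigroup. -/
abbrev Identity (α : Type*) := FreeSemigroup α × FreeSemigroup α

/-- The sequence of letters of a (nonempty) word. -/
def letters {α : Type*} (u : FreeSemigroup α) : List α := u.head :: u.tail

/-- `Derives Γ u v`: the identity `u ≈ v` can be derived from the set of identities `Γ` by the
rules of equational logic for semigroups. -/
inductive Derives {α : Type*} (Γ : Set (Identity α)) :
    FreeSemigroup α → FreeSemigroup α → Prop
  | subst (p : Identity α) (hp : p ∈ Γ) (θ : α → FreeSemigroup α) :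
      Derives Γ (FreeSemigroup.lift θ p.1) (FreeSemigroup.lift θ p.2)
  | refl (u : FreeSemigroup α) : Derives Γ u u
  | symm {u v : FreeSemigroup α} : Derives Γ u v → Derives Γ v u
  | trans {u v w : FreeSemigroup α} : Derives Γ u v → Derives Γ v w → Derives Γ u w
  | mul {u v u' v' : FreeSemigroup α} :
      Derives Γ u v → Derives Γ u' v' → Derives Γ (u * u') (v * v')

/-- A set of identities is finitely based if all its members can be derived from a finite
subset of it. -/
def IsFinitelyBased {α : Type*} (Γ : Set (Identity α)) : Prop :=
  ∃ Δ ⊆ Γ, Δ.Finite ∧ ∀ p ∈ Γ, Derives Δ p.1 p.2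

/-- The scattered subwords (subsequences) of length at most `m` of a sequence of letters. -/
def scatteredSubwords {α : Type*} (m : ℕ) (l : List α) : Set (List α) :=
  {w | w.length ≤ m ∧ w.Sublist l}

/-- `J α m`: the identities `u ≈ v` such that `u` and `v` have the same scattered subwords of
length at most `m`. -/
def J (α : Type*) (m : ℕ) : Set (Identity α) :=
  {p | scatteredSubwords m (letters p.1) = scatteredSubwords m (letters p.2)}

/-- The equational theory of a semigroup `S`: the identities over `α` that hold in `S`. -/
def equationalTheory (α : Type*) (S : Type*) [Semigroup S] : Set (Identity α) :=
  {p | ∀ φ : α → S, FreeSemigroup.lift φ p.1 = FreeSemigroup.lift φ p.2}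

/-- A reflexive binary relation on `X`. -/
@[ext]
structure ReflRel (X : Type*) where
  rel : X → X → Prop
  refl : ∀ x, rel x x

/-- The monoid of reflexive binary relations on `X` under composition. -/
instance (X : Type*) : Monoid (ReflRel X) where
  mul R T := ⟨Relation.Comp R.rel T.rel, fun x => ⟨x, R.refl x, T.refl x⟩⟩
  one := ⟨fun x y => x = y, fun _ => rfl⟩
  mul_assoc _ _ _ := ReflRel.ext Relation.comp_assoc
  one_mul _ := ReflRel.ext Relation.eq_comp
  mul_one _ := ReflRel.ext Relation.comp_eq

/-- A language over `B` is piecewise `m`-testable if it is a Boolean combination of the languages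
`B* b₁ B* b₂ ⋯ B* bₖ B*` with `k ≤ m`, that is, of the languages consisting of all words that have
`b₁ b₂ ⋯ bₖ` as a scattered subword. -/
def IsPiecewiseTestable {B : Type*} (m : ℕ) (L : Language B) : Prop :=
  L ∈ BooleanSubalgebra.closure
    {K : Language B | ∃ w : List B, w.length ≤ m ∧ ∀ v : List B, v ∈ K ↔ w.Sublist v}

/-- The syntactic congruence of a language: two words are congruent if no context
`a _ b` separates them with respect to membership in `L`. -/
def syntacticCon {B : Type*} (L : Language B) : Con (FreeMonoid B) where
  r u v := ∀ a b : FreeMonoid B,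
    FreeMonoid.toList (a * u * b) ∈ L ↔ FreeMonoid.toList (a * v * b) ∈ L
  iseqv := ⟨fun _ _ _ => Iff.rfl, fun h a b => (h a b).symm,
    fun h k a b => (h a b).trans (k a b)⟩
  mul' := by
    intro u v u' v' h k a b
    have h1 := h a (u' * b)
    have h2 := k (a * v) b
    simp only [mul_assoc] at h1 h2 ⊢
    exact h1.trans h2

/-- The syntactic monoid of a language. -/
abbrev SyntacticMonoid {B : Type*} (L : Language B) := (syntacticCon L).Quotient

/-- The equational theory of the piecewise `m`-testable languages: the identities that hold in the
syntactic monoid of every piecewise `m`-testable language over a finite alphabet (equivalently, in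
every member of the pseudovariety generated by these monoids). -/
def testableTheory (α : Type*) (m : ℕ) : Set (Identity α) :=
  {p | ∀ (B : Type) [Finite B] (L : Language B), IsPiecewiseTestable m L →
    p ∈ equationalTheory α (SyntacticMonoid L)}

end PiecewiseTestable

namespace PiecewiseTestable

open List

/-! A letter of a subword of a substituted word comes from a single block, so a subword of length at
most `m` meets at most `m` blocks. Hence `Sim m` survives substitution and concatenation, which
gives the syntactic monoid description. For reflexive relations, a path labelled by a word can be
shortened to fewer than `m + 1` steps by cutting loops, and conversely can idle at any letter; a
line of `m + 1` states detects a given word of length `m`.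

For `m ≤ 3`, Simon's theorem (`Sim.exists_common_superword`) reduces `Sim m` to insertions of one
letter `x` between `p` and `q`. These preserve `Sim m` exactly when `p` absorbs `x` after subwords
shorter than some `k ≤ m` and `q` absorbs it before subwords shorter than `m - k`. Up to reversal
only `(k, m - k) = (1,0), (1,1), (2,0), (2,1), (3,0)` occur. Each such insertion is a chain of
instances of identities of bounded size: auxiliary copies of `x` are inserted, moved past one letter
at a time, and removed.

For `m = k + 2 ≥ 4`, let `w = x y₀ ⋯ yₙ₋₁ x yₙ₋₁ ⋯ y₀ (z x)ᵏ`. Adding an `x` before `(z x)ᵏ`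
preserves `Sim m` but creates the subword `y₀ y₀ x zᵏ`, of length `m + 1`. An identity of `J` with
too few variables can neither create nor destroy this subword inside the `Sim m` class of `w`:
otherwise some variable would cover the last occurrences of two different `yᵢ`, which the subwords
missing from `w` forbid. As `n` is arbitrary, no finite basis exists. -/

/-- Two words have the same scattered subwords of length at most `m`. -/
def Sim {β : Type*} (m : ℕ) (s t : List β) : Prop :=
  ∀ w : List β, w.length ≤ m → (w <+ s ↔ w <+ t)

theorem mem_J_iff {α : Type*} {m : ℕ} {p : Identity α} :
    p ∈ J α m ↔ Sim m (letters p.1) (letters p.2) := by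
  simp only [J, scatteredSubwords, Set.mem_ofPred_eq, Set.ext_iff, Sim]
  exact forall_congr' fun w => and_congr_right_iff

theorem letters_injective {α : Type*} : Function.Injective (letters (α := α)) := by
  rintro ⟨a, s⟩ ⟨b, t⟩ h
  simp only [letters, cons.injEq] at h
  obtain ⟨rfl, rfl⟩ := h
  rfl

theorem exists_letters_eq {α : Type*} {l : List α} (hl : l ≠ []) :
    ∃ u : FreeSemigroup α, letters u = l := by
  cases l with
  | nil => exact absurd rfl hl
  | cons a l => exact ⟨⟨a, l⟩, rfl⟩

theorem letters_mul {α : Type*} (u v : FreeSemigroup α) :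
    letters (u * v) = letters u ++ letters v := by
  simp [letters]

theorem letters_of {α : Type*} (a : α) : letters (FreeSemigroup.of a) = [a] := rfl

theorem letters_lift {α β : Type*} (θ : α → FreeSemigroup β) (u : FreeSemigroup α) :
    letters (FreeSemigroup.lift θ u) = (letters u).flatMap fun a => letters (θ a) := by
  induction u using FreeSemigroup.recOnMul with
  | ih1 a => simp [letters_of]
  | ih2 a u h1 h2 => rw [map_mul, letters_mul, letters_mul, h1, h2, flatMap_append]

/-! ### Subword equivalence under concatenation, restriction and substitution -/

section Sim

variable {β γ : Type*} {m : ℕ} {s t u v : List β}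

theorem Sim.refl (m : ℕ) (s : List β) : Sim m s s := fun _ _ => Iff.rfl

theorem Sim.symm (h : Sim m s t) : Sim m t s := fun w hw => (h w hw).symm

theorem Sim.trans (h : Sim m s t) (k : Sim m t u) : Sim m s u :=
  fun w hw => (h w hw).trans (k w hw)

theorem Sim.of_sublist (h : s <+ t) (k : ∀ w : List β, w.length ≤ m → w <+ t → w <+ s) :
    Sim m s t :=
  fun w hw => ⟨fun hs => hs.trans h, k w hw⟩

theorem Sim.append (h : Sim m s t) (k : Sim m u v) : Sim m (s ++ u) (t ++ v) := by
  intro w hw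
  simp only [sublist_append_iff]
  constructor
  all_goals
    rintro ⟨w₁, w₂, rfl, h₁, h₂⟩
    simp only [length_append] at hw
  · exact ⟨w₁, w₂, rfl, (h _ (by omega)).1 h₁, (k _ (by omega)).1 h₂⟩
  · exact ⟨w₁, w₂, rfl, (h _ (by omega)).2 h₁, (k _ (by omega)).2 h₂⟩

theorem Sim.reverse (h : Sim m s t) : Sim m s.reverse t.reverse := by
  intro w hw
  rw [← reverse_reverse w, reverse_sublist, reverse_sublist]
  exact h _ (by simpa using hw)

theorem Sim.mem_iff (h : Sim m s t) (hm : 1 ≤ m) (a : β) : a ∈ s ↔ a ∈ t := by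
  simpa using h [a] (by simpa using hm)

theorem Sim.filter (h : Sim m s t) (P : β → Bool) : Sim m (s.filter P) (t.filter P) := by
  have key : ∀ {s t : List β}, Sim m s t → ∀ w : List β, w.length ≤ m →
      w <+ s.filter P → w <+ t.filter P := by
    intro s t h w hw hs
    have h1 := ((h w hw).1 (hs.trans filter_sublist)).filter P
    rwa [filter_eq_self.2] at h1
    intro a ha
    exact (mem_filter.1 (hs.subset ha)).2
  exact fun w hw => ⟨key h w hw, key h.symm w hw⟩

/-- Blocks that contribute no letter to `w` can be dropped; every remaining block uses up at least
one letter. -/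
theorem exists_sublist_of_sublist_flatMap (θ : β → List γ) :
    ∀ (s : List β) (w : List γ), w <+ s.flatMap θ →
      ∃ r : List β, r <+ s ∧ r.length ≤ w.length ∧ w <+ r.flatMap θ := by
  intro s
  induction s with
  | nil => intro w hw; exact ⟨[], by simp, by simp, by simpa using hw⟩
  | cons a s ih =>
    intro w hw
    rw [flatMap_cons, sublist_append_iff] at hw
    obtain ⟨w₁, w₂, rfl, h₁, h₂⟩ := hw
    obtain ⟨r, hr, hl, hw⟩ := ih w₂ h₂
    cases w₁ with
    | nil => exact ⟨r, hr.cons a, by simpa using hl, by simpa using hw⟩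
    | cons b w₁ =>
      refine ⟨a :: r, hr.cons_cons a, by simp; omega, ?_⟩
      rw [flatMap_cons]
      exact h₁.append hw

theorem Sim.flatMap (h : Sim m s t) (θ : β → List γ) :
    Sim m (s.flatMap θ) (t.flatMap θ) := by
  have key : ∀ {s t : List β}, Sim m s t → ∀ w : List γ, w.length ≤ m →
      w <+ s.flatMap θ → w <+ t.flatMap θ := by
    intro s t h w hw hs
    obtain ⟨r, hr, hl, hwr⟩ := exists_sublist_of_sublist_flatMap θ s w hs
    exact hwr.trans (((h r (hl.trans hw)).1 hr).flatMap θ)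
  exact fun w hw => ⟨key h w hw, key h.symm w hw⟩

theorem Sim.map (h : Sim m s t) (f : β → γ) : Sim m (s.map f) (t.map f) := by
  rw [map_eq_flatMap, map_eq_flatMap]
  exact h.flatMap _

end Sim

theorem Derives.sim {α : Type*} {m : ℕ} {Δ : Set (Identity α)} (hΔ : Δ ⊆ J α m)
    {u v : FreeSemigroup α} (h : Derives Δ u v) : Sim m (letters u) (letters v) := by
  induction h with
  | subst p hp θ =>
    rw [letters_lift, letters_lift]
    exact (mem_J_iff.1 (hΔ hp)).flatMap _
  | refl u => exact Sim.refl _ _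
  | symm _ ih => exact ih.symm
  | trans _ _ ih ih' => exact ih.trans ih'
  | mul _ _ ih ih' =>
    rw [letters_mul, letters_mul]
    exact ih.append ih'

theorem lift_eq_prod {α M : Type*} [Monoid M] (φ : α → M) (u : FreeSemigroup α) :
    FreeSemigroup.lift φ u = ((letters u).map φ).prod := by
  induction u using FreeSemigroup.recOnMul with
  | ih1 a => simp [letters_of]
  | ih2 a u h1 h2 => rw [map_mul, letters_mul, map_append, prod_append, h1, h2]

theorem mem_equationalTheory_iff {α M : Type*} [Monoid M] {p : Identity α} :
    p ∈ equationalTheory α M ↔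
      ∀ φ : α → M, ((letters p.1).map φ).prod = ((letters p.2).map φ).prod := by
  simp only [equationalTheory, Set.mem_ofPred_eq, lift_eq_prod]

/-! ### Syntactic monoids of piecewise testable languages -/

section Testable

variable {B : Type*} {m : ℕ} {L : Language B}

theorem IsPiecewiseTestable.mem_iff_of_sim (hL : IsPiecewiseTestable m L) :
    ∀ {u v : List B}, Sim m u v → (u ∈ L ↔ v ∈ L) := by
  have hL' : L ∈ BooleanSubalgebra.closure
    {K : Language B | ∃ w : List B, w.length ≤ m ∧ ∀ v : List B, v ∈ K ↔ w.Sublist v} := hL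
  induction hL' using BooleanSubalgebra.closure_bot_sup_induction with
  | mem K hK =>
    obtain ⟨w, hw, hK⟩ := hK
    intro u v h
    rw [hK, hK, h w hw]
  | bot => exact fun {_ _} _ => Iff.rfl
  | sup K hK K' hK' h h' => exact fun {_ _} k => or_congr (h hK k) (h' hK' k)
  | compl K hK h => exact fun {_ _} k => not_congr (h hK k)

theorem exists_isPiecewiseTestable_mem_iff {w : List B} (hw : w.length ≤ m) :
    ∃ L : Language B, IsPiecewiseTestable m L ∧ ∀ v : List B, v ∈ L ↔ w <+ v :=
  ⟨{v | w <+ v}, BooleanSubalgebra.subset_closure ⟨w, hw, fun _ => Iff.rfl⟩, fun _ => Iff.rfl⟩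

theorem prod_map_syntacticCon {α : Type*} (φ : α → SyntacticMonoid L) (r : α → List B)
    (hr : ∀ a, ((FreeMonoid.ofList (r a) : FreeMonoid B) : SyntacticMonoid L) = φ a) (l : List α) :
    (l.map φ).prod = ((FreeMonoid.ofList (l.flatMap r) : FreeMonoid B) : SyntacticMonoid L) := by
  induction l with
  | nil => rfl
  | cons a l ih => rw [map_cons, prod_cons, ih, ← hr a, flatMap_cons, FreeMonoid.ofList_append,
      Con.coe_mul]

theorem syntacticCon_coe_eq_iff {u v : List B} :
    ((FreeMonoid.ofList u : FreeMonoid B) : SyntacticMonoid L) =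
        ((FreeMonoid.ofList v : FreeMonoid B) : SyntacticMonoid L) ↔
      ∀ a b : List B, a ++ u ++ b ∈ L ↔ a ++ v ++ b ∈ L :=
  Con.eq _

end Testable

/-- Testable languages are taken over finite alphabets only, so the letters in play must be renamed
faithfully into some `Fin n`. -/
theorem exists_fin_retraction {α : Type*} (l : List α) (hl : l ≠ []) :
    ∃ (n : ℕ) (f : α → Fin n) (g : Fin n → α), ∀ a ∈ l, g (f a) = a := by
  classical
  have hpos : 0 < l.length := length_pos_of_ne_nil hl
  refine ⟨l.length, fun a => if h : a ∈ l then ⟨l.idxOf a, idxOf_lt_length_iff.2 h⟩ else ⟨0, hpos⟩,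
    l.get, ?_⟩
  intro a ha
  simp [ha]

theorem testableTheory_eq (α : Type*) (m : ℕ) : testableTheory α m = J α m := by
  ext p
  constructor
  · intro hp
    have key : ∀ w : List α, w.length ≤ m → (w <+ letters p.1 ↔ w <+ letters p.2) := by
      intro w hw
      -- The letters of `w` are included so that the renaming also reflects the relation of `w` to
      -- both sides.
      obtain ⟨n, f, g, hfg⟩ := exists_fin_retraction (letters p.1 ++ letters p.2 ++ w)
        (by simp [letters])
      have back : ∀ l : List α, (∀ a ∈ l, a ∈ letters p.1 ++ letters p.2 ++ w) →
          (w.map f <+ l.map f ↔ w <+ l) := by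
        intro l hl
        refine ⟨fun h => ?_, fun h => h.map f⟩
        have h1 := h.map g
        rw [map_map, map_map] at h1
        rwa [map_congr_left (g := id), map_congr_left (g := id) (l := l), map_id, map_id] at h1
        · exact fun a ha => hfg a (hl a ha)
        · exact fun a ha => hfg a (by simp [ha])
      obtain ⟨L, hL, hLw⟩ := exists_isPiecewiseTestable_mem_iff (w := w.map f)
        (by simpa using hw : _ ≤ m)
      have h1 := mem_equationalTheory_iff.1 (hp (Fin n) L hL)
        (fun a => ((FreeMonoid.ofList [f a] : FreeMonoid (Fin n)) : SyntacticMonoid L))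
      rw [prod_map_syntacticCon _ (fun a => [f a]) fun _ => rfl,
        prod_map_syntacticCon _ (fun a => [f a]) fun _ => rfl, syntacticCon_coe_eq_iff] at h1
      have h2 := h1 [] []
      rw [← map_eq_flatMap, ← map_eq_flatMap] at h2
      simp only [nil_append, append_nil, hLw] at h2
      rw [← back _ (by simp +contextual), ← back _ (by simp +contextual)]
      exact h2
    exact mem_J_iff.2 key
  · intro hp B _ L hL
    rw [mem_equationalTheory_iff]
    intro φ
    have hr : ∀ a, ∃ r : List B,
        ((FreeMonoid.ofList r : FreeMonoid B) : SyntacticMonoid L) = φ a :=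
      fun a => Quotient.exists_rep (φ a)
    choose r hr using hr
    rw [prod_map_syntacticCon φ r hr, prod_map_syntacticCon φ r hr, syntacticCon_coe_eq_iff]
    intro a b
    exact hL.mem_iff_of_sim
      (((Sim.refl m a).append ((mem_J_iff.1 hp).flatMap r)).append (Sim.refl m b))

/-! ### Monoids of reflexive relations -/

namespace ReflRel

variable {α X : Type*} (φ : α → ReflRel X)

theorem prod_cons_rel {a : α} {l : List α} {x y : X} :
    (((a :: l).map φ).prod).rel x y ↔ ∃ z, (φ a).rel x z ∧ ((l.map φ).prod).rel z y := by
  rw [map_cons, prod_cons]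
  rfl

theorem prod_append_rel {l k : List α} {x y : X} :
    (((l ++ k).map φ).prod).rel x y ↔
      ∃ z, ((l.map φ).prod).rel x z ∧ ((k.map φ).prod).rel z y := by
  rw [map_append, prod_append]
  rfl

variable {φ}

theorem prod_rel_of_sublist {w l : List α} (h : w <+ l) :
    ∀ {x y : X}, ((w.map φ).prod).rel x y → ((l.map φ).prod).rel x y := by
  induction h with
  | slnil => exact fun h => h
  | cons a _ ih => exact fun {x y} h => (prod_cons_rel φ).2 ⟨x, (φ a).refl x, ih h⟩
  | cons_cons a _ ih =>
    intro x y h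
    obtain ⟨z, h1, h2⟩ := (prod_cons_rel φ).1 h
    exact (prod_cons_rel φ).2 ⟨z, h1, ih h2⟩

/-- A path through more cut points than `X` has elements visits some point twice, and the loop
between the two visits can be removed. -/
theorem exists_short_sublist [Fintype X] {x y : X} (l : List α)
    (h : ((l.map φ).prod).rel x y) :
    ∃ w : List α, w.length < Fintype.card X ∧ w <+ l ∧ ((w.map φ).prod).rel x y := by
  induction hn : l.length using Nat.strong_induction_on generalizing l with
  | _ n ih =>
    subst hn
    by_cases hl : l.length < Fintype.card X
    · exact ⟨l, hl, Sublist.refl l, h⟩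
    have hv : ∀ i : Fin (l.length + 1), ∃ z, (((l.take i).map φ).prod).rel x z ∧
        (((l.drop i).map φ).prod).rel z y := by
      intro i
      rw [← prod_append_rel, take_append_drop]
      exact h
    choose v hv using hv
    obtain ⟨i, j, hij, hvij⟩ := Fintype.exists_ne_map_eq_of_card_lt v (by simp; omega)
    wlog hlt : i < j generalizing i j
    · exact this j i hij.symm hvij.symm (lt_of_le_of_ne (not_lt.1 hlt) hij.symm)
    have h1 := (prod_append_rel φ).2 ⟨v i, (hv i).1, hvij ▸ (hv j).2⟩
    have h2 : l.take i ++ l.drop j <+ l := by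
      conv_rhs => rw [← take_append_drop i l]
      exact (Sublist.refl _).append (drop_sublist_drop_left l (by exact hlt.le))
    have h3 : (l.take i ++ l.drop j).length < l.length := by
      have := j.2
      have : (i : ℕ) < j := hlt
      simp
      omega
    obtain ⟨w, hw, hs, hr⟩ := ih _ h3 _ h1 rfl
    exact ⟨w, hw, hs.trans h2, hr⟩

/-- The reflexive relations on `{0, …, m}` recognizing the words that have `w` as a scattered
subword. -/
def ofWord (m : ℕ) (w : List α) (a : α) : ReflRel (Fin (m + 1)) where
  rel i j := i = j ∨ (j : ℕ) = i + 1 ∧ w[(i : ℕ)]? = some a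
  refl _ := Or.inl rfl

theorem prod_ofWord_rel {m : ℕ} {w : List α} (hw : w.length ≤ m) (l : List α) :
    ∀ i : Fin (m + 1), (i : ℕ) ≤ w.length →
      (((l.map (ofWord m w)).prod).rel i ⟨w.length, Nat.lt_succ_of_le hw⟩ ↔ w.drop i <+ l) := by
  induction l with
  | nil =>
    intro i hi
    rw [sublist_nil, drop_eq_nil_iff]
    change i = _ ↔ _
    rw [Fin.ext_iff]
    simp only
    omega
  | cons a l ih =>
    intro i hi
    rw [prod_cons_rel, sublist_cons_iff]
    constructor
    · rintro ⟨z, rfl | ⟨hz, ha⟩, h⟩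
      · exact Or.inl ((ih _ hi).1 h)
      · obtain ⟨hlt, rfl⟩ := List.getElem?_eq_some_iff.1 ha
        refine Or.inr ⟨w.drop (i + 1), drop_eq_getElem_cons hlt, ?_⟩
        rw [← hz]
        exact (ih z (by omega)).1 h
    · rintro (h | ⟨r, hr, h⟩)
      · exact ⟨i, Or.inl rfl, (ih i hi).2 h⟩
      · have hlt : (i : ℕ) < w.length := by
          by_contra hn
          rw [drop_eq_nil_iff.2 (by omega)] at hr
          cases hr
        rw [drop_eq_getElem_cons hlt, cons.injEq] at hr
        obtain ⟨rfl, rfl⟩ := hr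
        refine ⟨⟨i + 1, by omega⟩, Or.inr ⟨rfl, getElem?_eq_getElem hlt⟩, ?_⟩
        exact (ih ⟨i + 1, by omega⟩ hlt).2 h

end ReflRel

theorem equationalTheory_reflRel_eq (α : Type*) (m : ℕ) :
    equationalTheory α (ReflRel (Fin (m + 1))) = J α m := by
  ext p
  rw [mem_equationalTheory_iff, mem_J_iff]
  constructor
  · intro hp w hw
    have key := fun l : List α => ReflRel.prod_ofWord_rel hw l 0 (by simp)
    simp only [Fin.val_zero, drop_zero] at key
    rw [← key, ← key, hp]
  · intro hp φ
    have key : ∀ {s t : List α}, Sim m s t → ∀ {x y : Fin (m + 1)},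
        ((s.map φ).prod).rel x y → ((t.map φ).prod).rel x y := by
      intro s t h x y hxy
      obtain ⟨w, hw, hs, hr⟩ := ReflRel.exists_short_sublist s hxy
      rw [Fintype.card_fin, Nat.lt_succ_iff] at hw
      exact ReflRel.prod_rel_of_sublist ((h w hw).1 hs) hr
    ext x y
    exact ⟨key hp, key hp.symm⟩

/-! ### Insertion of a letter and Simon's theorem -/

section Insertion

variable {β : Type*} {m : ℕ}

/-- Every scattered subword of `p` of length less than `k` can be followed by `x` in `p`. -/
def AbsorbsRight (k : ℕ) (p : List β) (x : β) : Prop :=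
  ∀ s : List β, s.length < k → s <+ p → s ++ [x] <+ p

/-- Every scattered subword of `q` of length less than `k` can be preceded by `x` in `q`. -/
def AbsorbsLeft (k : ℕ) (q : List β) (x : β) : Prop :=
  ∀ t : List β, t.length < k → t <+ q → x :: t <+ q

theorem absorbsLeft_iff_reverse {k : ℕ} {q : List β} {x : β} :
    AbsorbsLeft k q x ↔ AbsorbsRight k q.reverse x := by
  constructor
  · intro h s hs hsq
    have := (h s.reverse (by simpa using hs) (by rwa [← reverse_sublist, reverse_reverse])).reverse
    simpa using this
  · intro h t ht htq
    have := (h t.reverse (by simpa using ht) (by simpa using htq)).reverse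
    simpa using this

theorem absorbsLeft_zero (q : List β) (x : β) : AbsorbsLeft 0 q x :=
  fun _ h => absurd h (Nat.not_lt_zero _)

theorem AbsorbsRight.mem {k : ℕ} {p : List β} {x : β} (h : AbsorbsRight k p x) (hk : 0 < k) :
    x ∈ p := by
  simpa using h [] hk (nil_sublist p)

theorem AbsorbsLeft.mem {k : ℕ} {q : List β} {x : β} (h : AbsorbsLeft k q x) (hk : 0 < k) :
    x ∈ q := by
  simpa using h [] hk (nil_sublist q)

theorem absorbsRight_two {p' p'' : List β} {x : β} (hx : x ∈ p') (hp : ∀ c ∈ p'', c ∈ p') :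
    AbsorbsRight 2 (p' ++ x :: p'') x := by
  intro s hs hsp
  match s, hs with
  | [], _ => simp
  | [c], _ =>
    have hc : c ∈ p' := by
      have : c ∈ p' ++ x :: p'' := by simpa using hsp
      simp only [mem_append, mem_cons] at this
      rcases this with h | rfl | h
      exacts [h, hx, hp _ h]
    exact (singleton_sublist.2 hc).append ((nil_sublist p'').cons_cons x)

/-- In a subword `s x t` of length at most `m ≤ k + l` that uses the new `x`, either `s` is shorter
than `k` or `t` is shorter than `l`, so an old `x` can be used instead. -/
theorem sim_insert {k l : ℕ} {p q : List β} {x : β} (hp : AbsorbsRight k p x)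
    (hq : AbsorbsLeft l q x) (hm : m ≤ k + l) : Sim m (p ++ q) (p ++ x :: q) := by
  refine Sim.of_sublist ((Sublist.refl p).append (sublist_cons_self x q)) fun w hw hs => ?_
  obtain ⟨s, t, rfl, hsp, htq⟩ := sublist_append_iff.1 hs
  rcases sublist_cons_iff.1 htq with h | ⟨t, rfl, ht⟩
  · exact hsp.append h
  simp only [length_append, length_cons] at hw
  by_cases hsk : s.length < k
  · simpa using (hp s hsk hsp).append ht
  · exact hsp.append (hq t (by omega) ht)

theorem cons_sublist_of_not_sublist {a t p q : List β} {x : β} (h : a ++ x :: t <+ p ++ q)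
    (ha : ¬ a ++ [x] <+ p) : x :: t <+ q := by
  obtain ⟨l₁, l₂, he, h₁, h₂⟩ := sublist_append_iff.1 h
  rcases append_eq_append_iff.1 he with ⟨c, rfl, hc⟩ | ⟨c, rfl, rfl⟩
  · cases c with
    | nil =>
      rw [nil_append] at hc
      rwa [hc]
    | cons d c =>
      rw [cons_append, cons.injEq] at hc
      obtain ⟨rfl, rfl⟩ := hc
      exact absurd (((Sublist.refl a).append ((nil_sublist c).cons_cons x)).trans h₁) ha
  · exact (sublist_append_right c _).trans h₂

theorem exists_of_not_sim_insert {p q : List β} {x : β} (h : ¬ Sim m (p ++ q) (p ++ x :: q)) :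
    ∃ s t : List β, s.length + t.length < m ∧ s <+ p ∧ t <+ q ∧ ¬ s ++ [x] <+ p ∧
      ¬ x :: t <+ q := by
  by_contra! hn
  refine h (Sim.of_sublist ((Sublist.refl p).append (sublist_cons_self x q)) fun w hw hs => ?_)
  obtain ⟨s, t, rfl, hsp, htq⟩ := sublist_append_iff.1 hs
  rcases sublist_cons_iff.1 htq with h | ⟨t, rfl, ht⟩
  · exact hsp.append h
  simp only [length_append, length_cons] at hw
  by_cases hsx : s ++ [x] <+ p
  · simpa using hsx.append ht
  · exact hsp.append (hn s t (by omega) hsp ht hsx)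

/-- Converse of `sim_insert`. For the largest admissible `k < m`, some `s` of length at most `k`
cannot be followed by `x` in `p`; testing the words `s x t` then forces `x t` into `q`. -/
theorem Sim.exists_absorbs {p q : List β} {x : β} (h : Sim m (p ++ q) (p ++ x :: q)) :
    ∃ k ≤ m, AbsorbsRight k p x ∧ AbsorbsLeft (m - k) q x := by
  classical
  have h0 : AbsorbsRight 0 p x := fun _ h => absurd h (Nat.not_lt_zero _)
  have hk := Nat.findGreatest_spec (P := fun k => AbsorbsRight k p x) (Nat.zero_le m) h0
  have hkm : Nat.findGreatest (fun k => AbsorbsRight k p x) m ≤ m := Nat.findGreatest_le m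
  have hlast := fun n => Nat.findGreatest_is_greatest (P := fun k => AbsorbsRight k p x)
    (n := m) (k := n)
  generalize Nat.findGreatest (fun k => AbsorbsRight k p x) m = k at hk hkm hlast
  refine ⟨k, hkm, hk, ?_⟩
  rcases hkm.eq_or_lt with rfl | hlt
  · rw [Nat.sub_self]
    exact absorbsLeft_zero q x
  have hnot := hlast (k + 1) (Nat.lt_succ_self k) hlt
  simp only [AbsorbsRight, not_forall] at hnot
  obtain ⟨s, hs, hsp, hsx⟩ := hnot
  intro t ht htq
  refine cons_sublist_of_not_sublist ((h _ ?_).2 (hsp.append (htq.cons_cons x))) hsx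
  simp only [length_append, length_cons]
  omega

/-- Since `x a` is not in `r`, the word `x` forces what follows it to be found after `r`. This
transfers `y` into `g`; then `x' b y` transfers back and puts `b y` into `a f`. -/
theorem not_sim_of_obstruction {r f g x x' y : List β} {a b : β} (hab : a ≠ b)
    (h : Sim m (r ++ a :: f) (r ++ b :: g)) (hx : x <+ r) (hxa : ¬ x ++ [a] <+ r)
    (hx' : x' <+ r) (hxb : ¬ x' ++ [b] <+ r) (hy : y <+ a :: f) (hyb : ¬ b :: y <+ a :: f)
    (hl : x.length + y.length < m) (hl' : x'.length + y.length < m) : False := by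
  have key : ∀ y' : List β, y' <+ f → y'.length ≤ y.length → a :: y' <+ g := by
    intro y' hy' hlen
    have h1 := (h (x ++ a :: y') (by simp; omega)).1 (hx.append (hy'.cons_cons a))
    rcases sublist_cons_iff.1 (cons_sublist_of_not_sublist h1 hxa) with h2 | ⟨_, h2, _⟩
    · exact h2
    · exact absurd (cons.inj h2).1 hab
  have hyg : y <+ g := by
    rcases sublist_cons_iff.1 hy with h1 | ⟨y', rfl, h1⟩
    · exact (sublist_cons_self a y).trans (key y h1 le_rfl)
    · exact key y' h1 (by simp)
  have h1 := (h (x' ++ b :: y) (by simp; omega)).2 (hx'.append (hyg.cons_cons b))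
  exact hyb (cons_sublist_of_not_sublist h1 hxb)

theorem exists_common_superword_append (r f g : List β) (h : Sim m (r ++ f) (r ++ g)) :
    ∃ w : List β, r ++ f <+ w ∧ r ++ g <+ w ∧ Sim m (r ++ f) w := by
  induction hn : f.length + g.length using Nat.strong_induction_on generalizing r f g with
  | _ n ih =>
  subst hn
  match f, g with
  | [], g => exact ⟨r ++ g, by simp, Sublist.refl _, h⟩
  | a :: f, [] => exact ⟨r ++ a :: f, Sublist.refl _, by simp, Sim.refl _ _⟩
  | a :: f, b :: g =>
    by_cases hab : a = b
    · subst hab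
      obtain ⟨w, h1, h2, h3⟩ := ih (f.length + g.length) (by simp; omega) (r ++ [a]) f g
        (by simpa using h) rfl
      exact ⟨w, by simpa using h1, by simpa using h2, by simpa using h3⟩
    by_cases ha : Sim m (r ++ b :: g) (r ++ a :: b :: g)
    · obtain ⟨w, h1, h2, h3⟩ := ih (f.length + (b :: g).length) (by simp) (r ++ [a]) f (b :: g)
        (by simpa using h.trans ha) rfl
      refine ⟨w, by simpa using h1, ?_, by simpa using h3⟩
      exact ((Sublist.refl r).append (sublist_cons_self a _)).trans (by simpa using h2)
    by_cases hb : Sim m (r ++ a :: f) (r ++ b :: a :: f)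
    · obtain ⟨w, h1, h2, h3⟩ := ih ((a :: f).length + g.length) (by simp) (r ++ [b])
        (a :: f) g (by simpa using hb.symm.trans h) rfl
      refine ⟨w, ?_, by simpa using h2, hb.trans (by simpa using h3)⟩
      exact ((Sublist.refl r).append (sublist_cons_self b _)).trans (by simpa using h1)
    obtain ⟨x, y, hl, hx, hy, hxa, hya⟩ := exists_of_not_sim_insert ha
    obtain ⟨x', y', hl', hx', hy', hxb, hyb⟩ := exists_of_not_sim_insert hb
    -- The four lengths add up to less than `2 * m`, so one of the two exchanged pairs `(x, y')`,
    -- `(x', y)` is again short.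
    by_cases hc : x.length + y'.length < m
    · exact (not_sim_of_obstruction hab h hx hxa hx' hxb hy' hyb hc hl').elim
    · exact (not_sim_of_obstruction (Ne.symm hab) h.symm hx' hxb hx hxa hy hya
        (by omega) hl).elim

/-- Simon's theorem: two words with the same short scattered subwords have a common superword
with the same short scattered subwords. -/
theorem Sim.exists_common_superword {f g : List β} (h : Sim m f g) :
    ∃ w : List β, f <+ w ∧ g <+ w ∧ Sim m f w :=
  exists_common_superword_append [] f g h

/-- A reflexive and transitive relation, compatible with `Sim m` for the insertion of a letter,
contains `Sim m`. -/
theorem rel_of_sublist_of_sim {R : List β → List β → Prop} (hrefl : ∀ s, R s s)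
    (htrans : ∀ {s t u}, R s t → R t u → R s u)
    (hR : ∀ (p q : List β) (x : β), Sim m (p ++ q) (p ++ x :: q) → R (p ++ q) (p ++ x :: q))
    {u w : List β} (h : u <+ w) :
    ∀ r : List β, Sim m (r ++ u) (r ++ w) → R (r ++ u) (r ++ w) := by
  induction h with
  | slnil => exact fun r _ => hrefl _
  | @cons u w x h ih =>
    intro r hs
    have h1 : r ++ u <+ r ++ x :: u := (Sublist.refl r).append (sublist_cons_self x u)
    have h2 : r ++ x :: u <+ r ++ x :: w := (Sublist.refl r).append (h.cons_cons x)
    have hs1 : Sim m (r ++ u) (r ++ x :: u) :=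
      Sim.of_sublist h1 fun v hv hvs => (hs v hv).2 (hvs.trans h2)
    -- The intermediate word lies between two equivalent words in the subword order, hence is
    -- equivalent to both.
    have := ih (r ++ [x]) (by simpa using hs1.symm.trans hs)
    exact htrans (hR _ _ _ hs1) (by simpa using this)
  | @cons_cons u w x h ih =>
    intro r hs
    simpa using ih (r ++ [x]) (by simpa using hs)

theorem rel_of_sim {R : List β → List β → Prop} (hR : Equivalence R)
    (hins : ∀ (p q : List β) (x : β), Sim m (p ++ q) (p ++ x :: q) → R (p ++ q) (p ++ x :: q))
    {u v : List β} (h : Sim m u v) : R u v := by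
  obtain ⟨w, hu, hv, hs⟩ := h.exists_common_superword
  have key := fun (u : List β) (hu : u <+ w) =>
    rel_of_sublist_of_sim hR.refl hR.trans hins hu []
  exact hR.trans (key u hu hs) (hR.symm (key v hv (h.symm.trans hs)))

end Insertion

/-! ### The case `m ≤ 3`: reduction to identities of bounded size -/

section Closed

variable {β : Type*}

theorem absorbsLeft_one {q : List β} {x : β} (h : x ∈ q) : AbsorbsLeft 1 q x := by
  intro t ht _
  rw [Nat.lt_one_iff, length_eq_zero_iff] at ht
  simpa [ht] using h

theorem absorbsRight_one {p : List β} {x : β} (h : x ∈ p) : AbsorbsRight 1 p x := by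
  intro t ht _
  rw [Nat.lt_one_iff, length_eq_zero_iff] at ht
  simpa [ht] using h

/-- Any subword of length at most 2 can be moved into `A ++ B`, before the displayed `x`. -/
theorem absorbsRight_three {A B p : List β} {x : β} (hA : ∀ c ∈ B ++ x :: p, c ∈ A)
    (hB : ∀ c ∈ x :: p, c ∈ B) : AbsorbsRight 3 (A ++ B ++ x :: p) x := by
  intro s hs hsp
  refine Sublist.append (l₂ := A ++ B) (r₂ := x :: p) ?_ ((nil_sublist p).cons_cons x)
  rw [append_assoc] at hsp
  obtain ⟨s₁, s₂, rfl, h₁, h₂⟩ := sublist_append_iff.1 hsp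
  have hB' : ∀ c ∈ B ++ x :: p, c ∈ B := fun c hc =>
    (mem_append.1 hc).elim id (hB c)
  match s₁, s₂, hs with
  | s₁, [], _ => simpa using h₁.trans (sublist_append_left A B)
  | s₁, [c], _ => exact h₁.append (by simpa using hB' c (by simpa using h₂))
  | [], [c, d], _ =>
    have hc : c ∈ A := hA c (h₂.subset (by simp))
    have hd : d ∈ B := hB' d (h₂.subset (by simp))
    exact (singleton_sublist.2 hc).append (singleton_sublist.2 hd)
  | _ :: s₁, _ :: _ :: s₂, hs => simp at hs; omega
  | s₁, _ :: _ :: _ :: s₂, hs => simp at hs; omega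

/-- Two letters of a word occur in it in some order. -/
theorem exists_eq_of_mem_of_mem {x y : β} {A : List β} (hx : x ∈ A) (hy : y ∈ A) :
    ∃ a b c, A = a ++ x :: (b ++ y :: c) ∨ A = a ++ y :: (b ++ x :: c) ∨
      x = y ∧ A = a ++ x :: b := by
  obtain ⟨a, b, rfl⟩ := append_of_mem hx
  simp only [mem_append, mem_cons] at hy
  rcases hy with hy | rfl | hy
  · obtain ⟨c, d, rfl⟩ := append_of_mem hy
    exact ⟨c, d, b, Or.inr (Or.inl (by simp))⟩
  · exact ⟨a, b, [], Or.inr (Or.inr ⟨rfl, rfl⟩)⟩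
  · obtain ⟨c, d, rfl⟩ := append_of_mem hy
    exact ⟨a, c, d, Or.inl rfl⟩

/-- An equivalence relation on words which is compatible with concatenation and contains all
substitution instances of the pairs of short words over five variables related by `Sim m`. -/
structure IsInstanceClosed (m : ℕ) (E : List β → List β → Prop) : Prop where
  equiv : Equivalence E
  append : ∀ {s t s' t' : List β}, E s t → E s' t' → E (s ++ s') (t ++ t')
  inst : ∀ s t : List (Fin 5), s.length ≤ 9 → t.length ≤ 9 → Sim m s t →
    ∀ θ : Fin 5 → List β, E (s.flatMap θ) (t.flatMap θ)

namespace IsInstanceClosed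

variable {m : ℕ} {E : List β → List β → Prop}

theorem reverse (hE : IsInstanceClosed m E) :
    IsInstanceClosed m fun s t => E s.reverse t.reverse where
  equiv := ⟨fun _ => hE.equiv.refl _, hE.equiv.symm, hE.equiv.trans⟩
  append h h' := by
    rw [reverse_append, reverse_append]
    exact hE.append h' h
  inst s t hs ht h θ := by
    rw [reverse_flatMap, reverse_flatMap]
    exact hE.inst _ _ (by simpa using hs) (by simpa using ht) h.reverse _

theorem context (hE : IsInstanceClosed m E) {s t : List β} (h : E s t) (a b : List β) :
    E (a ++ s ++ b) (a ++ t ++ b) :=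
  hE.append (hE.append (hE.equiv.refl a) h) (hE.equiv.refl b)

/-- Variable 0 stands for the inserted letter, 1 for a second letter, and 2, 3, 4 for gaps. The
longest patterns used have 8 letters, hence 9 after the insertion. -/
theorem insert_inst (hE : IsInstanceClosed m E) {k l : ℕ} (p q : List (Fin 5)) (i : Fin 5)
    (hp : AbsorbsRight k p i) (hq : AbsorbsLeft l q i) (hm : m ≤ k + l)
    (hlen : p.length + q.length ≤ 8) (θ : Fin 5 → List β) :
    E (p.flatMap θ ++ q.flatMap θ) (p.flatMap θ ++ (θ i ++ q.flatMap θ)) := by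
  have := hE.inst (p ++ q) (p ++ i :: q) (by simp; omega) (by simp; omega)
    (sim_insert hp hq hm) θ
  simpa using this

theorem insert_one_zero (hE : IsInstanceClosed 1 E) {p q : List β} {x : β} (hx : x ∈ p) :
    E (p ++ q) (p ++ x :: q) := by
  obtain ⟨a, b, rfl⟩ := append_of_mem hx
  have := hE.insert_inst (k := 1) (l := 0) [0, 2] [] 0 (absorbsRight_one (by decide))
    (absorbsLeft_zero _ _) (by decide) (by decide) ![[x], [], b, [], []]
  simpa using hE.context this a q

theorem insert_one_one (hE : IsInstanceClosed 2 E) {p q : List β} {x : β} (hx : x ∈ p)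
    (hq : x ∈ q) : E (p ++ q) (p ++ x :: q) := by
  obtain ⟨a, b, rfl⟩ := append_of_mem hx
  obtain ⟨c, d, rfl⟩ := append_of_mem hq
  have := hE.insert_inst (k := 1) (l := 1) [0, 2] [4, 0] 0 (absorbsRight_one (by decide))
    (absorbsLeft_one (by decide)) (by decide) (by decide) ![[x], [], b, [], c]
  simpa using hE.context this a d

theorem insert_two_inst (hE : IsInstanceClosed m E) {q : List β} {x : β}
    (hm : m ≤ 2 ∨ m ≤ 3 ∧ x ∈ q) (p p' : List (Fin 5)) (hx : 0 ∈ p)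
    (hp : ∀ c ∈ p', c ∈ p) (hlen : p.length + p'.length ≤ 5) (h4 : 4 ∉ p)
    (θ : Fin 5 → List β) (hθ : θ 0 = [x]) :
    E ((p ++ 0 :: p').flatMap θ ++ q) ((p ++ 0 :: p').flatMap θ ++ x :: q) := by
  have hlen' : (p ++ 0 :: p').length ≤ 6 := by
    simp only [length_append, length_cons]
    omega
  rcases hm with hm | ⟨hm, hq⟩
  · have := hE.insert_inst (k := 2) (l := 0) (p ++ 0 :: p') [] 0 (absorbsRight_two hx hp)
      (absorbsLeft_zero _ _) hm (by simpa using hlen'.trans (by decide)) θ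
    simpa [hθ] using hE.context this [] q
  · obtain ⟨c, d, rfl⟩ := append_of_mem hq
    have := hE.insert_inst (k := 2) (l := 1) (p ++ 0 :: p') [4, 0] 0 (absorbsRight_two hx hp)
      (absorbsLeft_one (by decide)) hm (by simpa using hlen') (Function.update θ 4 c)
    have hcongr : (p ++ 0 :: p').flatMap (Function.update θ 4 c) = (p ++ 0 :: p').flatMap θ := by
      refine flatMap_congr fun i hi => Function.update_of_ne ?_ _ _
      rintro rfl
      simp only [mem_append, mem_cons] at hi
      rcases hi with hi | hi | hi
      exacts [h4 hi, absurd hi (by decide), h4 (hp _ hi)]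
    rw [hcongr] at this
    simpa [hθ] using hE.context this [] d

theorem insert_two_nil (hE : IsInstanceClosed m E) {p q : List β} {x : β}
    (hm : m ≤ 2 ∨ m ≤ 3 ∧ x ∈ q) (hx : x ∈ p) :
    E (p ++ x :: q) (p ++ x :: x :: q) := by
  obtain ⟨a, b, rfl⟩ := append_of_mem hx
  have := hE.insert_two_inst hm [0, 2] [] (by decide) (by decide) (by decide) (by decide)
    ![[x], [], b, [], []] rfl
  simpa using hE.context this a []

theorem insert_two_singleton (hE : IsInstanceClosed m E) {p q : List β} {x y : β}
    (hm : m ≤ 2 ∨ m ≤ 3 ∧ x ∈ q) (hx : x ∈ p) (hy : y ∈ p) :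
    E (p ++ x :: y :: q) (p ++ x :: y :: x :: q) := by
  obtain ⟨a, b, c, rfl | rfl | ⟨rfl, rfl⟩⟩ := exists_eq_of_mem_of_mem hx hy
  · have := hE.insert_two_inst hm [0, 2, 1, 3] [1] (by decide) (by decide) (by decide) (by decide)
      ![[x], [y], b, c, []] rfl
    simpa using hE.context this a []
  · have := hE.insert_two_inst hm [1, 2, 0, 3] [1] (by decide) (by decide) (by decide) (by decide)
      ![[x], [y], b, c, []] rfl
    simpa using hE.context this a []
  · have := hE.insert_two_inst hm [0, 2] [0] (by decide) (by decide) (by decide) (by decide)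
      ![[x], [], b, c, []] rfl
    simpa using hE.context this a []

/-- The block `p'` may contain many letters, so no single bounded identity suffices. Instead `x y p'
q ~ x y x p' q ~ x y x p' x q ~ x y p' x q`: the auxiliary `x` lets the induction go past `y` and is
then removed. -/
theorem insert_two (hE : IsInstanceClosed m E) {x : β} {q : List β}
    (hm : m ≤ 2 ∨ m ≤ 3 ∧ x ∈ q) (p' : List β) :
    ∀ p : List β, x ∈ p → (∀ c ∈ p', c ∈ p) →
      E (p ++ x :: (p' ++ q)) (p ++ x :: (p' ++ x :: q)) := by
  induction p' with
  | nil => exact fun p hx _ => hE.insert_two_nil hm hx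
  | cons y p' ih =>
    intro p hx hp
    have hy := hp y mem_cons_self
    have h1 := hE.insert_two_singleton (q := p' ++ q)
      (hm.imp_right fun h => ⟨h.1, mem_append_right _ h.2⟩) hx hy
    have h2 := ih (p ++ [x, y]) (by simp) fun c hc => mem_append_left _ (hp c (mem_cons_of_mem _ hc))
    have h3 := hE.insert_two_singleton (q := p' ++ x :: q)
      (hm.imp_right fun h => ⟨h.1, by simp⟩) hx hy
    refine hE.equiv.trans h1 (hE.equiv.trans ?_ (hE.equiv.symm h3))
    simpa using h2

/-- The first copy of `x y` plays the part of the second block in `absorbsRight_three`, so the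
unbounded `B` can be hidden in a gap variable. -/
theorem insert_three_inst (hE : IsInstanceClosed 3 E) {A : List β} {x y : β} (hx : x ∈ A)
    (hy : y ∈ A) (B q : List β) :
    E (A ++ B ++ x :: y :: x :: y :: q) (A ++ B ++ x :: y :: x :: y :: x :: q) := by
  obtain ⟨a, b, c, rfl | rfl | ⟨rfl, rfl⟩⟩ := exists_eq_of_mem_of_mem hx hy
  · have := hE.insert_inst (k := 3) (l := 0) ([0, 2, 1, 3] ++ [0, 1] ++ 0 :: [1]) [] 0
      (absorbsRight_three (by decide) (by decide)) (absorbsLeft_zero _ _) (by decide) (by decide)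
      ![[x], [y], b, c ++ B, []]
    simpa using hE.context this a q
  · have := hE.insert_inst (k := 3) (l := 0) ([1, 2, 0, 3] ++ [0, 1] ++ 0 :: [1]) [] 0
      (absorbsRight_three (by decide) (by decide)) (absorbsLeft_zero _ _) (by decide) (by decide)
      ![[x], [y], b, c ++ B, []]
    simpa using hE.context this a q
  · have := hE.insert_inst (k := 3) (l := 0) ([0, 2] ++ [0, 0] ++ 0 :: [0]) [] 0
      (absorbsRight_three (by decide) (by decide)) (absorbsLeft_zero _ _) (by decide) (by decide)
      ![[x], [], b ++ B, [], []]
    simpa using hE.context this a q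

/-- The new `x` and `y` are inserted before existing ones, so one occurrence on the right is
available and `insert_two` applies. -/
theorem double_pair (hE : IsInstanceClosed 3 E) {A B : List β} {x y : β}
    (hA : ∀ c ∈ B, c ∈ A) (hx : x ∈ B) (hy : y ∈ B) (q : List β) :
    E (A ++ B ++ x :: y :: q) (A ++ B ++ x :: y :: x :: y :: q) := by
  obtain ⟨b, c, hb⟩ := append_of_mem hx
  have h1 := hE.insert_two (x := x) (q := x :: y :: q) (Or.inr ⟨le_rfl, by simp⟩) c (A ++ b)
    (mem_append_left _ (hA x hx)) fun d hd => mem_append_left _ (hA d (by simp [hb, hd]))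
  have h1' : E (A ++ B ++ x :: y :: q) (A ++ B ++ x :: x :: y :: q) := by
    simpa [hb] using h1
  obtain ⟨b, c, hb⟩ := append_of_mem hy
  have h2 := hE.insert_two (x := y) (q := x :: y :: q) (Or.inr ⟨le_rfl, by simp⟩) (c ++ [x])
    (A ++ b) (mem_append_left _ (hA y hy)) (by
      intro d hd
      rcases mem_append.1 hd with hd | hd
      · exact mem_append_left _ (hA d (by simp [hb, hd]))
      · rw [mem_singleton.1 hd]
        exact mem_append_left _ (hA x hx))
  have h2' : E (A ++ B ++ x :: x :: y :: q) (A ++ B ++ x :: y :: x :: y :: q) := by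
    simpa [hb] using h2
  exact hE.equiv.trans h1' h2'

theorem insert_three_singleton (hE : IsInstanceClosed 3 E) {A B : List β} {x y : β}
    (hA : ∀ c ∈ B, c ∈ A) (hx : x ∈ B) (hy : y ∈ B) (q : List β) :
    E (A ++ B ++ x :: y :: q) (A ++ B ++ x :: y :: x :: q) :=
  hE.equiv.trans (hE.double_pair hA hx hy q)
    (hE.equiv.trans (hE.insert_three_inst (hA x hx) (hA y hy) B q)
      (hE.equiv.symm (hE.double_pair hA hx hy (x :: q))))

/-- Same scheme as in `insert_two`, with `insert_three_singleton` providing and removing the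
auxiliary `x`. -/
theorem insert_three (hE : IsInstanceClosed 3 E) {A : List β} {x : β} (q p : List β) :
    ∀ B : List β, (∀ c ∈ B, c ∈ A) → (∀ c ∈ x :: p, c ∈ B) →
      E (A ++ B ++ x :: (p ++ q)) (A ++ B ++ x :: (p ++ x :: q)) := by
  induction p with
  | nil =>
    intro B hA hB
    obtain ⟨b, c, hb⟩ := append_of_mem (hB x mem_cons_self)
    have hxA := hA x (hB x mem_cons_self)
    have := hE.insert_two (x := x) (q := x :: q) (Or.inr ⟨le_rfl, by simp⟩) c (A ++ b)
      (mem_append_left _ hxA) fun d hd => mem_append_left _ (hA d (by simp [hb, hd]))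
    simpa [hb] using this
  | cons y p ih =>
    intro B hA hB
    have hx := hB x mem_cons_self
    have hy := hB y (by simp)
    have h1 := hE.insert_three_singleton hA hx hy (p ++ q)
    have h2 := ih (B ++ [x, y])
      (by
        intro c hc
        simp only [mem_append, mem_cons, not_mem_nil, or_false] at hc
        rcases hc with hc | rfl | rfl
        exacts [hA _ hc, hA _ hx, hA _ hy])
      fun c hc => mem_append_left _ (hB c (by
        rcases mem_cons.1 hc with rfl | hc <;> simp [*]))
    have h3 := hE.insert_three_singleton hA hx hy (p ++ x :: q)
    refine hE.equiv.trans h1 (hE.equiv.trans ?_ (hE.equiv.symm h3))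
    simpa using h2

end IsInstanceClosed

theorem sublist_of_append_singleton_sublist {s p q : List β} {x : β} (hx : x ∉ q)
    (h : s ++ [x] <+ p ++ x :: q) : s <+ p := by
  by_cases hs : s ++ [x] <+ p
  · exact (sublist_append_left s [x]).trans hs
  obtain ⟨s₁, s₂, he, h₁, h₂⟩ := sublist_append_iff.1 h
  rcases append_eq_append_iff.1 he with ⟨c, rfl, hc⟩ | ⟨c, rfl, rfl⟩
  · exact (sublist_append_left s c).trans h₁
  · rcases sublist_cons_iff.1 h₂ with h | ⟨r, hr, h'⟩
    · exact absurd (h.subset (by simp)) hx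
    · cases c with
      | nil => simpa using h₁
      | cons d c =>
        rw [cons_append, cons.injEq] at hr
        obtain ⟨rfl, rfl⟩ := hr
        exact absurd (h'.subset (mem_append_right c mem_cons_self)) hx

theorem exists_eq_append_cons_not_mem {p : List β} {x : β} (h : x ∈ p) :
    ∃ a b, p = a ++ x :: b ∧ x ∉ b := by
  obtain ⟨a, b, hab, hx⟩ := eq_append_cons_of_mem (mem_reverse.2 h)
  refine ⟨b.reverse, a.reverse, ?_, by simpa using hx⟩
  rw [← reverse_reverse p, hab]
  simp

theorem exists_prefix_covering {p : List β} (hp : p ≠ []) :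
    ∃ a c b, p = a ++ c :: b ∧ c ∉ a ∧ ∀ d ∈ b, d ∈ a ++ [c] := by
  classical
  induction p using reverseRecOn with
  | nil => exact absurd rfl hp
  | append_singleton l e ih =>
    by_cases he : e ∈ l
    · obtain ⟨a, c, b, rfl, hc, hb⟩ := ih (ne_nil_of_mem he)
      refine ⟨a, c, b ++ [e], by simp, hc, ?_⟩
      intro d hd
      have hcov : ∀ d ∈ a ++ c :: b, d ∈ a ++ [c] := by
        intro d hd
        simp only [mem_append, mem_cons] at hd
        rcases hd with hd | rfl | hd
        exacts [by simp [hd], by simp, hb d hd]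
      rcases mem_append.1 hd with hd | hd
      · exact hb d hd
      · rw [mem_singleton.1 hd]
        exact hcov e he
    · exact ⟨l, e, [], by simp, he, by simp⟩

/-- Split at the last `x`: a letter that can be followed by `x` must occur before it. -/
theorem AbsorbsRight.exists_two {p : List β} {x : β} (h : AbsorbsRight 2 p x) :
    ∃ a b, p = a ++ x :: b ∧ x ∈ a ∧ ∀ c ∈ b, c ∈ a := by
  obtain ⟨a, b, rfl, hx⟩ := exists_eq_append_cons_not_mem (h.mem two_pos)
  have key : ∀ c ∈ a ++ x :: b, c ∈ a := fun c hc => singleton_sublist.1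
    (sublist_of_append_singleton_sublist hx (h [c] (by simp) (singleton_sublist.2 hc)))
  exact ⟨a, b, rfl, key x (by simp), fun c hc => key c (by simp [hc])⟩

theorem AbsorbsRight.exists_three {p : List β} {x : β} (h : AbsorbsRight 3 p x) :
    ∃ A B b, p = A ++ B ++ x :: b ∧ (∀ c ∈ B, c ∈ A) ∧ ∀ c ∈ x :: b, c ∈ B := by
  obtain ⟨a, b, rfl, hx⟩ := exists_eq_append_cons_not_mem (h.mem three_pos)
  have key : ∀ s : List β, s.length < 3 → s <+ a ++ x :: b → s <+ a := fun s hs hsp =>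
    sublist_of_append_singleton_sublist hx (h s hs hsp)
  have hxa : x ∈ a := by simpa using key [x] (by simp) (by simp)
  obtain ⟨A, e, B, rfl, he, hB⟩ := exists_prefix_covering (ne_nil_of_mem hxa)
  refine ⟨A ++ [e], B, b, by simp, hB, ?_⟩
  intro c hc
  -- The letter `e` ends the shortest prefix containing all letters of `a`, so it first occurs
  -- there; a `c` following `e` within `a` must lie in `B`.
  have h1 := key [e, c] (by simp) (by
    have : [e, c] <+ (A ++ [e]) ++ (B ++ x :: b) :=
      (sublist_append_right A [e]).append (singleton_sublist.2 (mem_append_right B hc))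
    simpa using this)
  rcases sublist_append_iff.1 h1 with ⟨s, t, hst, hs, ht⟩
  match s, hst with
  | [], hst =>
    rw [nil_append] at hst
    subst hst
    exact singleton_sublist.1 (cons_sublist_cons.1 ht)
  | d :: s, hst =>
    rw [cons_append, cons.injEq] at hst
    exact absurd (hs.subset (by simp [hst.1])) he

namespace IsInstanceClosed

variable {m : ℕ} {E : List β → List β → Prop}

/-- Insertion of a letter which is absorbed mostly by the left context. -/
theorem insert_right (hE : IsInstanceClosed m E) {k : ℕ} (hm3 : m ≤ 3) (hkm : k ≤ m) (hk : m < 2 * k)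
    {p q : List β} {x : β} (hp : AbsorbsRight k p x) (hq : AbsorbsLeft (m - k) q x) :
    E (p ++ q) (p ++ x :: q) := by
  obtain rfl | rfl | ⟨rfl, rfl⟩ : k = 1 ∨ k = 2 ∨ k = 3 ∧ m = 3 := by omega
  · obtain rfl : m = 1 := by omega
    exact hE.insert_one_zero (hp.mem one_pos)
  · obtain ⟨a, b, rfl, hx, hb⟩ := hp.exists_two
    have hm : m ≤ 2 ∨ m ≤ 3 ∧ x ∈ q := by
      by_cases h : m ≤ 2
      · exact Or.inl h
      · exact Or.inr ⟨hm3, hq.mem (by omega)⟩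
    simpa using hE.insert_two hm b a hx hb
  · obtain ⟨A, B, b, rfl, hA, hB⟩ := hp.exists_three
    simpa using hE.insert_three q b B hA hB

theorem of_sim (hE : IsInstanceClosed m E) (h0 : 0 < m) (hm : m ≤ 3) {u v : List β}
    (h : Sim m u v) : E u v := by
  refine rel_of_sim hE.equiv (fun p q x hs => ?_) h
  obtain ⟨k, hkm, hp, hq⟩ := hs.exists_absorbs
  rcases lt_trichotomy m (2 * k) with hk | rfl | hk
  · exact hE.insert_right hm hkm hk hp hq
  · obtain rfl : k = 1 := by omega
    exact hE.insert_one_one (hp.mem one_pos) (hq.mem (by decide))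
  -- The right context absorbs more than the left one; reversal exchanges them.
  · have := hE.reverse.insert_right (k := m - k) hm (by omega) (by omega)
      (absorbsLeft_iff_reverse.1 hq) (x := x) (q := p.reverse)
      (absorbsLeft_iff_reverse.2 (by rwa [reverse_reverse, Nat.sub_sub_self hkm]))
    simpa using this

end IsInstanceClosed

end Closed

/-! ### Finite bases for `m ≤ 3` -/

section FiniteBasis

variable {α : Type*}

/-- Derivability of an identity between possibly empty words. -/
def DerivesWord (Δ : Set (Identity α)) (s t : List α) : Prop :=
  s = t ∨ ∃ u v : FreeSemigroup α, letters u = s ∧ letters v = t ∧ Derives Δ u v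

theorem derivesWord_equivalence (Δ : Set (Identity α)) : Equivalence (DerivesWord Δ) where
  refl _ := Or.inl rfl
  symm := by
    rintro s t (rfl | ⟨u, v, hu, hv, h⟩)
    exacts [Or.inl rfl, Or.inr ⟨v, u, hv, hu, h.symm⟩]
  trans := by
    rintro s t r (rfl | ⟨u, v, hu, hv, h⟩) (rfl | ⟨u', v', hu', hv', h'⟩)
    · exact Or.inl rfl
    · exact Or.inr ⟨u', v', hu', hv', h'⟩
    · exact Or.inr ⟨u, v, hu, hv, h⟩
    · obtain rfl := letters_injective (hv.trans hu'.symm)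
      exact Or.inr ⟨u, v', hu, hv', h.trans h'⟩

theorem DerivesWord.append {Δ : Set (Identity α)} {s t s' t' : List α} (h : DerivesWord Δ s t)
    (h' : DerivesWord Δ s' t') : DerivesWord Δ (s ++ s') (t ++ t') := by
  rcases h with rfl | ⟨u, v, rfl, rfl, h⟩ <;> rcases h' with rfl | ⟨u', v', rfl, rfl, h'⟩
  · exact Or.inl rfl
  · by_cases hs : s = []
    · exact Or.inr ⟨u', v', by simp [hs], by simp [hs], h'⟩
    · obtain ⟨r, rfl⟩ := exists_letters_eq hs
      exact Or.inr ⟨r * u', r * v', letters_mul _ _, letters_mul _ _, (Derives.refl r).mul h'⟩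
  · by_cases hs : s' = []
    · exact Or.inr ⟨u, v, by simp [hs], by simp [hs], h⟩
    · obtain ⟨r, rfl⟩ := exists_letters_eq hs
      exact Or.inr ⟨u * r, v * r, letters_mul _ _, letters_mul _ _, h.mul (Derives.refl r)⟩
  · exact Or.inr ⟨u * u', v * v', letters_mul _ _, letters_mul _ _, h.mul h'⟩

theorem DerivesWord.derives {Δ : Set (Identity α)} {u v : FreeSemigroup α}
    (h : DerivesWord Δ (letters u) (letters v)) : Derives Δ u v := by
  rcases h with h | ⟨u', v', hu, hv, h⟩
  · rw [letters_injective h]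
    exact Derives.refl v
  · rwa [← letters_injective hu, ← letters_injective hv]

/-- The identities of `J α m` between short words over the five variables `ι 0, …, ι 4`. -/
def shortIdentities (m : ℕ) (ι : Fin 5 → α) : Set (Identity α) :=
  {p | p ∈ J α m ∧ ∃ s t : List (Fin 5), s.length ≤ 9 ∧ t.length ≤ 9 ∧
    letters p.1 = s.map ι ∧ letters p.2 = t.map ι}

theorem shortIdentities_finite (m : ℕ) (ι : Fin 5 → α) : (shortIdentities m ι).Finite := by
  have h1 : (List.map ι '' {l | l.length ≤ 9}).Finite := (finite_length_le (Fin 5) 9).image _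
  refine ((h1.prod h1).preimage (f := Prod.map letters letters)
    (letters_injective.prodMap letters_injective).injOn).subset ?_
  rintro p ⟨_, s, t, hs, ht, h1, h2⟩
  exact ⟨⟨s, hs, h1.symm⟩, ⟨t, ht, h2.symm⟩⟩

theorem filter_flatMap_ne_nil {β γ : Type*} (θ : β → List γ) (D : β → Bool)
    (hD : ∀ i, D i = false → θ i = []) (s : List β) : (s.filter D).flatMap θ = s.flatMap θ := by
  induction s with
  | nil => rfl
  | cons a s ih =>
    rw [filter_cons, flatMap_cons, ← ih]
    cases h : D a
    · simp [hD a h]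
    · simp

/-- Semigroup substitutions cannot erase variables. Those sent to the empty word are first deleted
from both sides, which preserves `Sim m`; as `m > 0`, both sides then become empty together or not
at all. -/
theorem isInstanceClosed_derivesWord {m : ℕ} (hm : 0 < m) {ι : Fin 5 → α}
    (hι : Function.Injective ι) :
    IsInstanceClosed m (DerivesWord (shortIdentities m ι)) where
  equiv := derivesWord_equivalence _
  append := DerivesWord.append
  inst := by
    classical
    intro s t hs ht h θ
    have hD : ∀ i, decide (θ i ≠ []) = false → θ i = [] := fun i hi => by simpa using hi
    rw [← filter_flatMap_ne_nil θ _ hD s, ← filter_flatMap_ne_nil θ _ hD t]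
    have h' := h.filter fun i => decide (θ i ≠ [])
    have hs' := (length_filter_le (fun i => decide (θ i ≠ [])) s).trans hs
    have ht' := (length_filter_le (fun i => decide (θ i ≠ [])) t).trans ht
    have hsθ : ∀ i ∈ s.filter fun i => decide (θ i ≠ []), θ i ≠ [] := by simp
    have htθ : ∀ i ∈ t.filter fun i => decide (θ i ≠ []), θ i ≠ [] := by simp
    generalize s.filter (fun i => decide (θ i ≠ [])) = s' at *
    generalize t.filter (fun i => decide (θ i ≠ [])) = t' at *
    by_cases hnil : s' = []
    · have : t' = [] := eq_nil_iff_forall_not_mem.2 fun a ha => by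
        simpa [hnil] using (h'.mem_iff hm a).2 ha
      exact Or.inl (by rw [hnil, this])
    have hnil' : t' ≠ [] := by
      obtain ⟨a, ha⟩ := exists_mem_of_ne_nil s' hnil
      exact ne_nil_of_mem ((h'.mem_iff hm a).1 ha)
    obtain ⟨u, hu⟩ := exists_letters_eq (l := s'.map ι) (by simpa using hnil)
    obtain ⟨v, hv⟩ := exists_letters_eq (l := t'.map ι) (by simpa using hnil')
    have hσ : ∀ a, ∃ f : FreeSemigroup α, ∀ i, ι i = a → θ i ≠ [] → letters f = θ i := by
      intro a
      by_cases ha : ∃ i, ι i = a ∧ θ i ≠ []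
      · obtain ⟨i, rfl, hi⟩ := ha
        obtain ⟨f, hf⟩ := exists_letters_eq hi
        exact ⟨f, fun j hj _ => by rw [hf, hι hj]⟩
      · exact ⟨FreeSemigroup.of a, fun i hi hi' => absurd ⟨i, hi, hi'⟩ ha⟩
    choose σ hσ using hσ
    have key : ∀ l : List (Fin 5), (∀ i ∈ l, θ i ≠ []) →
        (l.map ι).flatMap (fun a => letters (σ a)) = l.flatMap θ := by
      intro l hl
      rw [flatMap_map]
      exact flatMap_congr fun i hi => hσ _ i rfl (hl i hi)
    refine Or.inr ⟨FreeSemigroup.lift σ u, FreeSemigroup.lift σ v, ?_, ?_, ?_⟩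
    · rw [letters_lift, hu, key s' hsθ]
    · rw [letters_lift, hv, key t' htθ]
    · have hmem : (u, v) ∈ shortIdentities m ι :=
        ⟨mem_J_iff.2 (by rw [hu, hv]; exact h'.map ι), s', t', hs', ht', hu, hv⟩
      exact Derives.subst _ hmem σ

theorem isFinitelyBased_J_zero [Nontrivial α] : IsFinitelyBased (J α 0) := by
  classical
  obtain ⟨a, b, hab⟩ := exists_pair_ne α
  refine ⟨{(FreeSemigroup.of a, FreeSemigroup.of b)}, ?_, Set.finite_singleton _, ?_⟩
  · rw [Set.singleton_subset_iff, mem_J_iff]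
    intro w hw
    rw [Nat.le_zero, length_eq_zero_iff] at hw
    simp [hw]
  · rintro ⟨u, v⟩ -
    have := Derives.subst (Γ := {(FreeSemigroup.of a, FreeSemigroup.of b)}) _ rfl
      (fun c => if c = a then u else v)
    simpa [hab.symm] using this

theorem isFinitelyBased_J [Infinite α] {m : ℕ} (hm : m ≤ 3) : IsFinitelyBased (J α m) := by
  rcases Nat.eq_zero_or_pos m with rfl | h0
  · exact isFinitelyBased_J_zero
  have ι : Fin 5 ↪ α := Fin.valEmbedding.trans (Infinite.natEmbedding α)
  exact ⟨shortIdentities m ι, fun p hp => hp.1, shortIdentities_finite m ι, fun p hp =>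
    ((isInstanceClosed_derivesWord h0 ι.injective).of_sim h0 hm (mem_J_iff.1 hp)).derives⟩

end FiniteBasis

/-! ### The case `m ≥ 4`: occurrences in substituted words -/

theorem pair_sublist_or {β : Type*} {l : List β} {a b : β} (ha : a ∈ l) (hb : b ∈ l) (hab : a ≠ b) :
    [a, b] <+ l ∨ [b, a] <+ l := by
  obtain ⟨c, d, rfl⟩ := append_of_mem ha
  simp only [mem_append, mem_cons] at hb
  rcases hb with hb | hb | hb
  · exact Or.inr ((singleton_sublist.2 hb).append ((nil_sublist d).cons_cons a))
  · exact absurd hb.symm hab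
  · exact Or.inl (((singleton_sublist.2 hb).cons_cons a).trans (sublist_append_right c _))

theorem exists_eq_of_append_cons_sublist_flatMap {V β : Type*} (θ : V → List β) {l r : List β} {x : β} :
    ∀ {t : List V}, l ++ x :: r <+ t.flatMap θ →
      ∃ t₁ v t₂ g h, t = t₁ ++ v :: t₂ ∧ θ v = g ++ x :: h ∧ l <+ t₁.flatMap θ ++ g ∧
        r <+ h ++ t₂.flatMap θ := by
  intro t
  induction t generalizing l with
  | nil => intro h; simp at h
  | cons v t ih =>
    intro h
    rw [flatMap_cons, append_sublist_iff] at h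
    obtain ⟨p, q, hpq, hl, hr⟩ := h
    obtain ⟨p', q', rfl, hx, hr'⟩ := cons_sublist_iff.1 hr
    obtain ⟨a, b, rfl⟩ := append_of_mem hx
    have hpq' : θ v ++ t.flatMap θ = (p ++ a) ++ (x :: (b ++ q')) := by simp [hpq]
    have hl' : l <+ p ++ a := hl.trans (sublist_append_left p a)
    replace hr' : r <+ b ++ q' := hr'.trans (sublist_append_right b q')
    rcases append_eq_append_iff.1 hpq' with ⟨c, hc, hc'⟩ | ⟨c, hc, hc'⟩
    · rw [hc, sublist_append_iff] at hl'
      obtain ⟨l₁, l₂, rfl, h₁, h₂⟩ := hl'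
      obtain ⟨t₁, w, t₂, g, h, rfl, hw, hg, hh⟩ := ih (l := l₂) (by
        rw [hc']
        exact h₂.append (hr'.cons_cons x))
      refine ⟨v :: t₁, w, t₂, g, h, rfl, hw, ?_, hh⟩
      rw [flatMap_cons, append_assoc]
      exact h₁.append hg
    · cases c with
      | nil =>
        rw [nil_append] at hc'
        obtain ⟨t₁, w, t₂, g, h, rfl, hw, hg, hh⟩ := ih (l := []) (by
          rw [← hc', nil_append]
          exact hr'.cons_cons x)
        refine ⟨v :: t₁, w, t₂, g, h, rfl, hw, ?_, hh⟩
        rw [flatMap_cons, hc]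
        exact hl'.trans (by simp)
      | cons y c =>
        rw [cons_append, cons.injEq] at hc'
        obtain ⟨rfl, hc'⟩ := hc'
        exact ⟨[], v, t, p ++ a, c, rfl, hc, by simpa using hl', by rwa [← hc']⟩

section Counting

variable {V β : Type*} [DecidableEq β]

theorem count_flatMap_filter (θ : V → List β) (a : β) (P : V → Bool)
    (hP : ∀ v, a ∈ θ v → P v = true) (t : List V) :
    ((t.filter P).flatMap θ).count a = (t.flatMap θ).count a := by
  induction t with
  | nil => rfl
  | cons v t ih =>
    rw [filter_cons, flatMap_cons, count_append, ← ih]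
    cases h : P v
    · have : a ∉ θ v := fun ha => by simp [hP v ha] at h
      simp [count_eq_zero_of_not_mem this]
    · simp

theorem length_filter_le_count_add_count (θ : V → List β) {a b : β} (P : V → Bool)
    (hP : ∀ v, P v = true → a ∈ θ v ∨ b ∈ θ v) (t : List V) :
    (t.filter P).length ≤ (t.flatMap θ).count a + (t.flatMap θ).count b := by
  induction t with
  | nil => simp
  | cons v t ih =>
    rw [filter_cons, flatMap_cons, count_append, count_append]
    split_ifs with h
    · rcases hP v h with h | h <;> have := count_pos_iff.2 h <;> simp only [length_cons] <;> omega
    · omega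

theorem length_filter_le_count (θ : V → List β) {a : β} (P : V → Bool)
    (hP : ∀ v, P v = true → a ∈ θ v) (t : List V) :
    (t.filter P).length ≤ (t.flatMap θ).count a := by
  induction t with
  | nil => simp
  | cons v t ih =>
    rw [filter_cons, flatMap_cons, count_append]
    split_ifs with h
    · have := count_pos_iff.2 (hP v h)
      simp only [length_cons]
      omega
    · omega

theorem Sim.count_eq {m k : ℕ} {s t : List β} (h : Sim m s t) {a : β} (ht : t.count a = k)
    (hk : k < m) : s.count a = k := by
  have h1 := (h (replicate k a) (by simp; omega)).2 (replicate_sublist_iff.2 ht.ge)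
  have h2 := mt (h (replicate (k + 1) a) (by simp; omega)).1
    (by rw [replicate_sublist_iff, ht]; omega)
  rw [replicate_sublist_iff] at h1 h2
  omega

end Counting

/-- The properties of a word over the letters `x`, `z`, `y 0, …, y (n - 1)` used to bound the
number of variables of identities: there are two occurrences of each `y i` and `k` occurrences
of `z`, and some scattered subwords are excluded. -/
structure IsZigzag {β : Type*} [DecidableEq β] (n k : ℕ) (x z : β) (y : ℕ → β) (u : List β) :
    Prop where
  count_y : ∀ i < n, u.count (y i) = 2
  count_z : u.count z = k
  not_zero_zero : ∀ j < n, ¬ [y 0, y 0, y j] <+ u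
  not_x_zero : ∀ i j, i ≤ j → j < n → ¬ [y j, y i, x, y 0] <+ u
  not_alternating : ∀ i j, i < j → j < n → ¬ [y i, y j, y i, y j] <+ u

/-! ### A subword that identities in few variables preserve -/

section Invariance

variable {V β : Type*} [DecidableEq β] {m n k : ℕ} {x z : β} {y : ℕ → β}

theorem IsZigzag.of_sim {u v : List β} (hm : 4 ≤ m) (hk : k < m) (h : Sim m u v)
    (hv : IsZigzag n k x z y v) : IsZigzag n k x z y u where
  count_y i hi := h.count_eq (hv.count_y i hi) (by omega)
  count_z := h.count_eq hv.count_z hk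
  not_zero_zero j hj := mt (h _ (by simp; omega)).1 (hv.not_zero_zero j hj)
  not_x_zero i j hij hj := mt (h _ (by simpa using hm)).1 (hv.not_x_zero i j hij hj)
  not_alternating i j hij hj := mt (h _ (by simpa using hm)).1 (hv.not_alternating i j hij hj)

theorem exists_last_occurrence (θ : V → List β) {a : β} {s : List V} (h : a ∈ s.flatMap θ) :
    ∃ s₁ c s₂, s = s₁ ++ c :: s₂ ∧ a ∈ θ c ∧ a ∉ s₂.flatMap θ := by
  induction s with
  | nil => simp at h
  | cons v s ih =>
    by_cases hs : a ∈ s.flatMap θ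
    · obtain ⟨s₁, c, s₂, rfl, hc, hn⟩ := ih hs
      exact ⟨v :: s₁, c, s₂, rfl, hc, hn⟩
    · refine ⟨[], v, s, rfl, ?_, hs⟩
      rw [flatMap_cons, mem_append] at h
      exact h.resolve_right hs

theorem two_le_count_iff {l : List β} {a : β} : [a, a] <+ l ↔ 2 ≤ l.count a := by
  rw [← replicate_sublist_iff]
  rfl

/-- A variable which lies in `s` before an occurrence of `x` followed by `y 0` cannot cover the
last occurrences of two letters `y i` and `y j`. -/
theorem IsZigzag.not_cover_two {s r₁ r₂ : List V} {v c : V} {θ : V → List β}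
    (hs : s = r₁ ++ v :: r₂) (hu : IsZigzag n k x z y (s.flatMap θ)) (hx : x ∈ θ v)
    (hc : c ∈ r₁) (h0 : y 0 ∈ r₂.flatMap θ) {i j : ℕ} (hij : i < j) (hj : j < n)
    (hy : y i ≠ y j) {s₁ s₂ : List V} (hs' : s = s₁ ++ c :: s₂) (hi : y i ∈ θ c)
    (hi' : y i ∉ s₂.flatMap θ) (hjc : y j ∈ θ c) : False := by
  have htail : [x, y 0] <+ (v :: r₂).flatMap θ := by
    rw [flatMap_cons]
    exact (singleton_sublist.2 hx).append (singleton_sublist.2 h0)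
  have hsub : ∀ w w' : List β, w <+ r₁.flatMap θ → w' <+ (v :: r₂).flatMap θ →
      w ++ w' <+ s.flatMap θ := by
    intro w w' h h'
    rw [hs, flatMap_append]
    exact h.append h'
  have hθ : ∀ {l : List V} {d : V}, d ∈ l → θ d <+ l.flatMap θ := by
    intro l d hd
    simpa using (singleton_sublist.2 hd).flatMap θ
  -- The opposite order would give `y j, y i, x, y 0`.
  have hlt : [y i, y j] <+ θ c := (pair_sublist_or hi hjc hy).resolve_right fun h =>
    hu.not_x_zero i j hij.le hj (hsub _ _ (h.trans (hθ hc)) htail)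
  by_cases hc2 : c ∈ v :: r₂
  · exact hu.not_alternating i j hij hj (hsub _ _ (hlt.trans (hθ hc)) (hlt.trans (hθ hc2)))
  -- Since `c` does not occur from `v` on, the last `y i` comes before `v`; then so do both
  -- occurrences of `y i`.
  have hn : y i ∉ (v :: r₂).flatMap θ := by
    rcases append_eq_append_iff.1 (hs.symm.trans hs') with ⟨a, _, ha⟩ | ⟨a, _, ha⟩
    · exact absurd (by simp [ha]) hc2
    · cases a with
      | nil =>
        rw [nil_append] at ha
        exact absurd (by simp [← ha]) hc2
      | cons d a =>
        rw [cons_append, cons.injEq] at ha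
        intro h
        apply hi'
        rw [ha.2, flatMap_append]
        exact mem_append_right _ h
  have h2 := hu.count_y i (hij.trans hj)
  rw [hs, flatMap_append, count_append, count_eq_zero_of_not_mem hn, add_zero] at h2
  exact hu.not_x_zero i i le_rfl (hij.trans hj) (hsub _ _ (two_le_count_iff.2 h2.ge) htail)

/-- An identity of `J` in less than `n` variables cannot create the scattered subword
`y₀ y₀ x zᵏ`. -/
theorem IsZigzag.sublist_of_sublist {s t : List V} (θ : V → List β) (S : Finset V)
    (hS : S.card < n) (hsS : ∀ c ∈ s, c ∈ S) (hk : 0 < k) (hn : 0 < n) (hst : Sim (k + 2) s t)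
    (hy : ∀ i j, y i = y j → i = j)
    (hs : IsZigzag n k x z y (s.flatMap θ)) (ht : IsZigzag n k x z y (t.flatMap θ))
    (hT : [y 0, y 0] ++ x :: replicate k z <+ t.flatMap θ) :
    [y 0, y 0] ++ x :: replicate k z <+ s.flatMap θ := by
  obtain ⟨t₁, v, t₂, g, h, htv, hv, hg, hh⟩ := exists_eq_of_append_cons_sublist_flatMap θ hT
  rw [two_le_count_iff] at hg
  rw [replicate_sublist_iff] at hh
  set P : V → Bool := fun v => decide (z ∈ θ v ∨ y 0 ∈ θ v) with hP
  have hPz : ∀ v, z ∈ θ v → P v = true := fun v h => by simp [hP, h]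
  have hPy : ∀ v, y 0 ∈ θ v → P v = true := fun v h => by simp [hP, h]
  -- The images contain `k` letters `z` and two letters `y 0`, so at most `k + 2` positions satisfy
  -- `P`. Each filtered word is therefore short enough to transfer to the other side.
  have hfilter : s.filter P = t.filter P := by
    have key : ∀ {s t : List V}, Sim (k + 2) s t → IsZigzag n k x z y (s.flatMap θ) →
        s.filter P <+ t.filter P := by
      intro s t hst hs
      have h1 := length_filter_le_count_add_count θ (a := z) (b := y 0) P
        (fun v hv => by simpa [hP] using hv) s
      rw [hs.count_z, hs.count_y 0 hn] at h1
      have h2 := ((hst _ h1).1 filter_sublist).filter P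
      simpa only [filter_filter, Bool.and_self] using h2
    exact (key hst hs).antisymm (key hst.symm ht)
  -- If `v` survives the filter, it has a matching occurrence in `s` with as many `y 0` before it
  -- and as many `z` after it.
  by_cases hPv : P v = true
  · rw [htv, filter_append, filter_cons_of_pos hPv] at hfilter
    obtain ⟨s₁, s', hs', h1, h2⟩ := filter_eq_append_iff.1 hfilter
    obtain ⟨s₂, s₃, rfl, h3, _, h4⟩ := filter_eq_cons_iff.1 h2
    have e1 : ∀ a, (∀ v, a ∈ θ v → P v = true) →
        ((s₁ ++ s₂).flatMap θ).count a = (t₁.flatMap θ).count a := by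
      intro a ha
      rw [← count_flatMap_filter θ a P ha, ← count_flatMap_filter θ a P ha t₁, filter_append, h1,
        filter_eq_nil_iff.2 h3, append_nil]
    have e2 : (s₃.flatMap θ).count z = (t₂.flatMap θ).count z := by
      rw [← count_flatMap_filter θ z P hPz, ← count_flatMap_filter θ z P hPz t₂, h4]
    have hsplit : s.flatMap θ = ((s₁ ++ s₂).flatMap θ ++ g) ++ x :: (h ++ s₃.flatMap θ) := by
      rw [hs']
      simp [hv]
    rw [hsplit]
    refine Sublist.append (two_le_count_iff.2 ?_) ((replicate_sublist_iff.2 ?_).cons_cons x)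
    · rw [count_append, e1 _ hPy, ← count_append]
      exact hg
    · rw [count_append, e2, ← count_append]
      exact hh
  · have hzv : z ∉ θ v := fun h => hPv (hPz v h)
    have hyv : y 0 ∉ θ v := fun h => hPv (hPy v h)
    have hxv : x ∈ θ v := by simp [hv]
    have hg' : 2 ≤ (t₁.flatMap θ).count (y 0) := by
      rwa [count_append, count_eq_zero_of_not_mem (a := y 0) (l := g), add_zero] at hg
      exact fun h => hyv (by simp [hv, h])
    have hh' : k ≤ (t₂.flatMap θ).count z := by
      rwa [count_append, count_eq_zero_of_not_mem (a := z) (l := h), zero_add] at hh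
      exact fun h => hzv (by simp [hv, h])
    by_contra hnot
    -- The word formed by `c`, `v` and the variables of `t₂` carrying `z` has length at most `k +
    -- 2`, so it embeds in `s`. All `z` needed then follow `v`, and if no `y 0` did, the excluded
    -- subword would appear in `s`.
    have key : ∀ c ∈ t₁, ∃ r₁ r₂, s = r₁ ++ v :: r₂ ∧ c ∈ r₁ ∧ y 0 ∈ r₂.flatMap θ := by
      intro c hc
      set Q : V → Bool := fun v => decide (z ∈ θ v) with hQ
      have hlen := length_filter_le_count θ (a := z) Q (fun v hv => by simpa [hQ] using hv) t
      rw [ht.count_z] at hlen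
      have hlen2 : (t₂.filter Q).length ≤ (t.filter Q).length := by
        rw [htv, filter_append, filter_cons]
        split_ifs <;> (simp; try omega)
      have hsub : [c] ++ v :: t₂.filter Q <+ s := by
        refine (hst _ (by simp; omega)).2 ?_
        rw [htv]
        exact (singleton_sublist.2 hc).append (filter_sublist.cons_cons v)
      obtain ⟨p, q, rfl, hcp, hq⟩ := append_sublist_iff.1 hsub
      obtain ⟨p', q', rfl, hvp, hq'⟩ := cons_sublist_iff.1 hq
      obtain ⟨a, b, rfl⟩ := append_of_mem hvp
      refine ⟨p ++ a, b ++ q', by simp, mem_append_left _ (singleton_sublist.1 hcp), ?_⟩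
      by_contra hy0
      apply hnot
      have hsplit : (p ++ ((a ++ v :: b) ++ q')).flatMap θ =
          (p ++ a).flatMap θ ++ (θ v ++ (b ++ q').flatMap θ) := by simp
      have h2 := hs.count_y 0 hn
      rw [hsplit, count_append, count_append, count_eq_zero_of_not_mem hyv,
        count_eq_zero_of_not_mem hy0] at h2
      have h3 := (hq'.trans (sublist_append_right b q')).flatMap θ |>.count_le z
      rw [count_flatMap_filter θ z Q (fun v hv => by simpa [hQ] using hv)] at h3
      rw [hsplit]
      refine (two_le_count_iff.2 (by omega)).append ?_
      exact (singleton_sublist.2 hxv).append (replicate_sublist_iff.2 (hh'.trans h3))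
    have hlast : ∀ i : Fin n, ∃ s₁ c s₂, s = s₁ ++ c :: s₂ ∧ y i ∈ θ c ∧ y i ∉ s₂.flatMap θ :=
      fun i => exists_last_occurrence θ (count_pos_iff.1 (by rw [hs.count_y i i.2]; omega))
    choose a c b hac hyc hyb using hlast
    have hcS : ∀ i ∈ (Finset.univ : Finset (Fin n)), c i ∈ S := fun i _ =>
      hsS _ (by rw [hac i]; simp)
    -- Fewer than `n` variables carry the last occurrences of the `n` letters `y i`.
    obtain ⟨i, -, j, -, hij, hcij⟩ := Finset.exists_ne_map_eq_of_card_lt_of_maps_to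
      (by simpa using hS) hcS
    wlog hlt : i < j generalizing i j
    · exact this j i hij.symm hcij.symm (lt_of_le_of_ne (not_lt.1 hlt) hij.symm)
    have hct : c i ∈ t := (hst.mem_iff (by omega) _).1 (by rw [hac i]; simp)
    -- Otherwise some `y i` would follow both occurrences of `y 0`.
    have hct₁ : c i ∈ t₁ := by
      by_contra hc
      rw [htv, mem_append] at hct
      apply ht.not_zero_zero i i.2
      have h1 : [y i] <+ (v :: t₂).flatMap θ := singleton_sublist.2
        (mem_flatMap.2 ⟨c i, hct.resolve_left hc, hyc i⟩)
      rw [htv, flatMap_append]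
      exact (two_le_count_iff.2 hg').append h1
    obtain ⟨r₁, r₂, hr, hcr, h0⟩ := key _ hct₁
    refine hs.not_cover_two hr hxv hcr h0 (i := i) (j := j) hlt j.2
      (fun h => hij (Fin.ext (hy _ _ h))) (hac i) (hyc i) (hyb i) ?_
    rw [hcij]
    exact hyc j

end Invariance

/-! ### The zigzag words -/

section ZigzagWord

variable {β : Type*} {n k : ℕ} {x z : β} {y : ℕ → β}

/-- The word `x y₀ ⋯ yₙ₋₁ x yₙ₋₁ ⋯ y₀`. -/
def zigzagPrefix (n : ℕ) (x : β) (y : ℕ → β) : List β :=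
  (x :: (range n).map y) ++ x :: ((range n).map y).reverse

/-- The word `(z x)ᵏ`. -/
def zigzagSuffix (k : ℕ) (x z : β) : List β := (replicate k [z, x]).flatten

theorem zigzagSuffix_succ (k : ℕ) (x z : β) :
    zigzagSuffix (k + 1) x z = z :: x :: zigzagSuffix k x z := by
  simp [zigzagSuffix, replicate_succ]

theorem mem_zigzagSuffix {c : β} (h : c ∈ zigzagSuffix k x z) : c = z ∨ c = x := by
  simp only [zigzagSuffix, mem_flatten, mem_replicate] at h
  obtain ⟨l, ⟨-, rfl⟩, hc⟩ := h
  simpa using hc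

theorem sublist_zigzagSuffix : ∀ {k : ℕ} {t : List β}, t.length ≤ k → (∀ c ∈ t, c = z ∨ c = x) →
    t <+ zigzagSuffix k x z := by
  intro k
  induction k with
  | zero =>
    intro t ht _
    rw [Nat.le_zero, length_eq_zero_iff] at ht
    simp [ht]
  | succ k ih =>
    intro t ht hc
    cases t with
    | nil => exact nil_sublist _
    | cons d t =>
      have h := ih (t := t) (by simpa using ht) fun c hc' => hc c (mem_cons_of_mem _ hc')
      rw [zigzagSuffix_succ]
      rcases hc d mem_cons_self with rfl | rfl
      · exact (h.cons x).cons_cons d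
      · exact (h.cons_cons d).cons z

theorem absorbsLeft_zigzagSuffix (k : ℕ) (x z : β) :
    AbsorbsLeft k (zigzagSuffix k x z) x := by
  intro t ht hsub
  cases k with
  | zero => exact absurd ht (Nat.not_lt_zero _)
  | succ k =>
    rw [zigzagSuffix_succ]
    exact ((sublist_zigzagSuffix (by omega) fun c hc => mem_zigzagSuffix (hsub.subset hc)).cons_cons
      x).cons z

theorem sim_zigzag (n k : ℕ) (x z : β) (y : ℕ → β) :
    Sim (k + 2) (zigzagPrefix n x y ++ zigzagSuffix k x z)
      (zigzagPrefix n x y ++ x :: zigzagSuffix k x z) :=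
  sim_insert (k := 2) (absorbsRight_two mem_cons_self fun c hc =>
    mem_cons_of_mem x (mem_reverse.1 hc)) (absorbsLeft_zigzagSuffix k x z) (by omega)

theorem lt_of_pair_sublist_map_range (hy : Function.Injective y) {i j : ℕ}
    (h : [y i, y j] <+ (range n).map y) : i < j := by
  have h1 : ((range n).map y).Pairwise fun a b => ∃ i j, a = y i ∧ b = y j ∧ i < j :=
    pairwise_map.2 (pairwise_lt_range.imp fun {i j} h => ⟨i, j, rfl, rfl, h⟩)
  obtain ⟨i', j', hi, hj, hlt⟩ := pairwise_pair.1 (h1.sublist h)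
  rwa [hy hi, hy hj]

theorem sublist_of_cons_sublist_cons {a b : β} {l r : List β} (hab : a ≠ b)
    (h : a :: l <+ b :: r) : a :: l <+ r := by
  rcases sublist_cons_iff.1 h with h | ⟨_, h, _⟩
  · exact h
  · exact absurd (cons.inj h).1 hab

theorem sublist_or_of_append_sublist_append {u a v p q : List β}
    (h : u ++ a ++ v <+ p ++ q) (ha : a.length ≤ 1) : u ++ a <+ p ∨ a ++ v <+ q := by
  match a, ha with
  | [], _ =>
    obtain ⟨s, t, he, hs, ht⟩ := sublist_append_iff.1 h
    simp only [append_nil, nil_append] at he ⊢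
    rcases append_eq_append_iff.1 he with ⟨c, rfl, _⟩ | ⟨c, _, rfl⟩
    · exact Or.inl ((sublist_append_left u c).trans hs)
    · exact Or.inr ((sublist_append_right c v).trans ht)
  | [d], _ =>
    by_cases hs : u ++ [d] <+ p
    · exact Or.inl hs
    · exact Or.inr (cons_sublist_of_not_sublist (by simpa using h) hs)

variable [DecidableEq β]

theorem count_zigzagSuffix (hxz : x ≠ z) (k : ℕ) : (zigzagSuffix k x z).count z = k := by
  induction k with
  | zero => rfl
  | succ k ih => simp [zigzagSuffix_succ, hxz, ih]

theorem isZigzag_zigzag (hy : Function.Injective y) (hxz : x ≠ z) (hxy : ∀ i, x ≠ y i)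
    (hzy : ∀ i, z ≠ y i) :
    IsZigzag n k x z y (zigzagPrefix n x y ++ zigzagSuffix k x z) := by
  have hZ : ∀ i, y i ∉ zigzagSuffix k x z := fun i h => by
    rcases mem_zigzagSuffix h with h | h
    exacts [hzy i h.symm, hxy i h.symm]
  have hmem : ∀ a, (∀ i, a ≠ y i) → a ∉ (range n).map y := fun a ha h => by
    obtain ⟨i, -, rfl⟩ := mem_map.1 h
    exact ha i rfl
  have hrev : ∀ i j, [y i, y j] <+ ((range n).map y).reverse ++ zigzagSuffix k x z → j < i := by
    intro i j h
    rcases sublist_or_of_append_sublist_append (u := [y i]) (a := [y j]) (v := []) h le_rfl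
      with h | h
    · have := reverse_sublist.2 h
      rw [reverse_reverse] at this
      exact lt_of_pair_sublist_map_range hy this
    · exact absurd (singleton_sublist.1 h) (hZ j)
  have hfst : ∀ i j, [y i, y j] <+ x :: (range n).map y → i < j := fun i j h =>
    lt_of_pair_sublist_map_range hy (sublist_of_cons_sublist_cons (hxy i).symm h)
  have hassoc : zigzagPrefix n x y ++ zigzagSuffix k x z = (x :: (range n).map y) ++
      (x :: (((range n).map y).reverse ++ zigzagSuffix k x z)) := by
    simp [zigzagPrefix]
  rw [hassoc]
  refine ⟨?_, ?_, ?_, ?_, ?_⟩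
  · intro i hi
    have h1 : ((range n).map y).count (y i) = 1 :=
      count_eq_one_of_mem ((nodup_range).map hy) (mem_map_of_mem (mem_range.2 hi))
    simp [hxy i, count_eq_zero_of_not_mem (hZ i), h1]
  · simp [hxz, count_eq_zero_of_not_mem (hmem z hzy), count_zigzagSuffix hxz]
  · intro j _ h
    rcases sublist_or_of_append_sublist_append (u := [y 0]) (a := [y 0]) (v := [y j]) h le_rfl
      with h | h
    · exact lt_irrefl _ (hfst _ _ h)
    · exact Nat.not_lt_zero _ (hrev _ _ (sublist_of_cons_sublist_cons (hxy 0).symm h))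
  · intro i j hij _ h
    rcases sublist_or_of_append_sublist_append (u := [y j]) (a := [y i]) (v := [x, y 0]) h le_rfl
      with h | h
    · exact absurd (hfst _ _ h) (not_lt.2 hij)
    · have h' := (sublist_cons_self _ _).trans (sublist_of_cons_sublist_cons (hxy i).symm h)
      rcases sublist_or_of_append_sublist_append (u := [x]) (a := []) (v := [y 0]) h' (by simp)
        with h | h
      · exact hmem x hxy (by simpa using h)
      · exact hZ 0 (by simpa using h)
  · intro i j hij _ h
    rcases sublist_or_of_append_sublist_append (u := [y i, y j]) (a := [y i]) (v := [y j]) h le_rfl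
      with h | h
    · exact absurd (hfst _ _ ((sublist_cons_self _ _).trans h)) hij.not_gt
    · exact absurd (hrev _ _ (sublist_of_cons_sublist_cons (hxy i).symm h)) hij.not_gt

/-- The first `x` after both `y 0` comes after the first `z`, so only `k - 1` letters `z` remain. -/
theorem not_sublist_zigzag (hy : Function.Injective y) (hxz : x ≠ z) (hxy : ∀ i, x ≠ y i)
    (hk : 0 < k) :
    ¬ [y 0, y 0] ++ x :: replicate k z <+ zigzagPrefix n x y ++ zigzagSuffix k x z := by
  intro h
  rcases sublist_or_of_append_sublist_append (u := [y 0, y 0]) (a := [x]) (v := replicate k z)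
    (by simpa using h) le_rfl with h | h
  · rcases sublist_or_of_append_sublist_append (u := [y 0]) (a := [y 0]) (v := [x]) h le_rfl
      with h | h
    · exact lt_irrefl _ (lt_of_pair_sublist_map_range hy
        (sublist_of_cons_sublist_cons (hxy 0).symm h))
    · have h' := (sublist_of_cons_sublist_cons (hxy 0).symm h).subset
        (mem_cons_of_mem _ mem_cons_self)
      obtain ⟨i, -, hi⟩ := mem_map.1 (mem_reverse.1 h')
      exact hxy i hi.symm
  · obtain ⟨k, rfl⟩ := Nat.exists_eq_add_of_lt hk
    rw [zero_add, zigzagSuffix_succ] at h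
    have h' : replicate (k + 1) z <+ zigzagSuffix k x z :=
      cons_sublist_cons.1 (sublist_of_cons_sublist_cons hxz h)
    rw [replicate_sublist_iff, count_zigzagSuffix hxz] at h'
    omega

end ZigzagWord

/-! ### No finite basis for `m ≥ 4` -/

section NotFinitelyBased

variable {α : Type*} [DecidableEq α] {n k : ℕ} {x z : α} {y : ℕ → α}

/-- The contexts `a` and `b` are treated as the images of two extra variables, which accounts for
the `+ 2` in the bound on `S`. -/
theorem IsZigzag.sublist_of_subst {w s t : List α} (hw : IsZigzag n k x z y w) (hk : 2 ≤ k)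
    (hy : Function.Injective y) (S : Finset α) (hS : S.card + 2 < n) (hsS : ∀ c ∈ s, c ∈ S)
    (hst : Sim (k + 2) s t) (θ : α → List α) (a b : List α)
    (hs : Sim (k + 2) (a ++ s.flatMap θ ++ b) w)
    (hT : [y 0, y 0] ++ x :: replicate k z <+ a ++ t.flatMap θ ++ b) :
    [y 0, y 0] ++ x :: replicate k z <+ a ++ s.flatMap θ ++ b := by
  have hflat : ∀ l : List α, (([Sum.inr false] ++ l.map Sum.inl) ++ [Sum.inr true]).flatMap
      (Sum.elim θ fun i : Bool => bif i then b else a) = a ++ l.flatMap θ ++ b := by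
    intro l
    simp [flatMap_map]
  have hst' : Sim (k + 2) (([Sum.inr false] ++ s.map Sum.inl) ++ [Sum.inr true] : List (α ⊕ Bool))
      (([Sum.inr false] ++ t.map Sum.inl) ++ [Sum.inr true]) :=
    ((Sim.refl _ _).append (hst.map _)).append (Sim.refl _ _)
  have hts := (hst'.flatMap (Sum.elim θ fun i : Bool => bif i then b else a)).symm
  rw [← hflat] at hs hT ⊢
  refine IsZigzag.sublist_of_sublist _ (S.disjSum Finset.univ) (by simpa using hS) ?_ (by omega)
    (by omega) hst' (fun i j h => hy h) (hw.of_sim (by omega) (by omega) hs)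
    (hw.of_sim (by omega) (by omega) (hts.trans hs)) hT
  intro c hc
  rcases c with c | c
  · simpa using hsS c (by simpa using hc)
  · simp

/-- Quantifying over contexts handles products: `u u'` becomes `v u'` and then `v v'`, the unchanged
factor joining the context. -/
theorem Derives.sublist_iff {Δ : Set (Identity α)} (hΔ : Δ ⊆ J α (k + 2)) {w : List α}
    (hw : IsZigzag n k x z y w) (hk : 2 ≤ k) (hy : Function.Injective y) (S : Finset α)
    (hS : S.card + 2 < n) (hΔS : ∀ p ∈ Δ, ∀ c, c ∈ letters p.1 ∨ c ∈ letters p.2 → c ∈ S)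
    {u v : FreeSemigroup α} (h : Derives Δ u v) :
    ∀ a b : List α, Sim (k + 2) (a ++ letters u ++ b) w →
      ([y 0, y 0] ++ x :: replicate k z <+ a ++ letters u ++ b ↔
        [y 0, y 0] ++ x :: replicate k z <+ a ++ letters v ++ b) := by
  have ctx : ∀ {u v : FreeSemigroup α}, Derives Δ u v → ∀ a b : List α,
      Sim (k + 2) (a ++ letters u ++ b) w → Sim (k + 2) (a ++ letters v ++ b) w :=
    fun h a b hs => (((Sim.refl _ a).append (h.sim hΔ).symm).append (Sim.refl _ b)).trans hs
  induction h with
  | subst p hp θ =>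
    intro a b hs
    have hs' := ctx (Derives.subst p hp θ) a b hs
    have hsim := mem_J_iff.1 (hΔ hp)
    rw [letters_lift] at hs hs'
    rw [letters_lift, letters_lift]
    exact ⟨hw.sublist_of_subst hk hy S hS (fun c hc => hΔS p hp c (Or.inr hc)) hsim.symm _ a b hs',
      hw.sublist_of_subst hk hy S hS (fun c hc => hΔS p hp c (Or.inl hc)) hsim _ a b hs⟩
  | refl u => exact fun _ _ _ => Iff.rfl
  | symm h ih => exact fun a b hs => (ih a b (ctx h.symm a b hs)).symm
  | trans h _ ih ih' => exact fun a b hs => (ih a b hs).trans (ih' a b (ctx h a b hs))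
  | @mul u v u' v' h h' ih ih' =>
    intro a b hs
    rw [letters_mul] at hs
    rw [letters_mul, letters_mul]
    have e1 := ih a (letters u' ++ b) (by simpa using hs)
    have h2 := ctx h a (letters u' ++ b) (by simpa using hs)
    have e2 := ih' (a ++ letters v) b (by simpa using h2)
    simp only [append_assoc] at e1 e2 ⊢
    exact e1.trans e2

end NotFinitelyBased

theorem not_isFinitelyBased_J {α : Type*} [Infinite α] {m : ℕ} (hm : 4 ≤ m) :
    ¬ IsFinitelyBased (J α m) := by
  classical
  rintro ⟨Δ, hΔ, hfin, hder⟩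
  obtain ⟨k, rfl⟩ : ∃ k, m = k + 2 := ⟨m - 2, by omega⟩
  set S : Finset α := hfin.toFinset.biUnion fun p =>
    (letters p.1).toFinset ∪ (letters p.2).toFinset with hS
  have hΔS : ∀ p ∈ Δ, ∀ c, c ∈ letters p.1 ∨ c ∈ letters p.2 → c ∈ S := by
    intro p hp c hc
    rw [hS, Finset.mem_biUnion]
    exact ⟨p, by simpa using hp, by simpa using hc⟩
  let ι := Infinite.natEmbedding α
  have hy : Function.Injective fun i => ι (i + 2) := fun i j h => by simpa using ι.injective h
  have hxz : ι 0 ≠ ι 1 := by simp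
  have hxy : ∀ i, ι 0 ≠ ι (i + 2) := by simp
  have hzy : ∀ i, ι 1 ≠ ι (i + 2) := by simp
  have hw := isZigzag_zigzag (n := S.card + 3) (k := k) hy hxz hxy hzy
  have hsim := sim_zigzag (S.card + 3) k (ι 0) (ι 1) fun i => ι (i + 2)
  have hnot := not_sublist_zigzag (n := S.card + 3) (k := k) hy hxz hxy (by omega)
  have hyes : [ι (0 + 2), ι (0 + 2)] ++ ι 0 :: replicate k (ι 1) <+
      zigzagPrefix (S.card + 3) (ι 0) (fun i => ι (i + 2)) ++
        ι 0 :: zigzagSuffix k (ι 0) (ι 1) := by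
    refine Sublist.append ?_ (Sublist.cons_cons _ ?_)
    · rw [two_le_count_iff]
      have := hw.count_y 0 (by omega)
      rw [count_append, count_eq_zero_of_not_mem (l := zigzagSuffix k (ι 0) (ι 1))] at this
      · exact this.ge
      · intro h
        rcases mem_zigzagSuffix h with h | h
        exacts [hzy 0 h.symm, hxy 0 h.symm]
    · rw [replicate_sublist_iff, count_zigzagSuffix hxz]
  obtain ⟨u, hu⟩ := exists_letters_eq (l := zigzagPrefix (S.card + 3) (ι 0) (fun i => ι (i + 2)) ++
    zigzagSuffix k (ι 0) (ι 1)) (by simp [zigzagPrefix])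
  obtain ⟨v, hv⟩ := exists_letters_eq (l := zigzagPrefix (S.card + 3) (ι 0) (fun i => ι (i + 2)) ++
    ι 0 :: zigzagSuffix k (ι 0) (ι 1)) (by simp)
  rw [← hu, ← hv] at hsim
  have hiff := (hder (u, v) (mem_J_iff.2 hsim)).sublist_iff hΔ hw (by omega) hy S (by omega) hΔS
    [] [] (by simpa [hu] using Sim.refl _ _)
  simp only [nil_append, append_nil, hu, hv] at hiff
  exact hnot (hiff.2 hyes)

end PiecewiseTestable

theorem mainTheorem3 {α : Type*} [Countable α] [Infinite α] (m : ℕ) :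
    (PiecewiseTestable.IsFinitelyBased (PiecewiseTestable.J α m) ↔ m ≤ 3) ∧
    PiecewiseTestable.testableTheory α m = PiecewiseTestable.J α m ∧
    PiecewiseTestable.equationalTheory α (PiecewiseTestable.ReflRel (Fin (m + 1))) =
      PiecewiseTestable.J α m := by
  refine ⟨⟨fun h => ?_, PiecewiseTestable.isFinitelyBased_J⟩,
    PiecewiseTestable.testableTheory_eq α m, PiecewiseTestable.equationalTheory_reflRel_eq α m⟩
  by_contra hm
  exact PiecewiseTestable.not_isFinitelyBased_J (by omega) h
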